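/- Let $\mathbb H=\{(z_1,z_2)\in\mathbb C^2:|z_1|<|z_2|<1\}$ be the Hartogs triangle with Lebesgue measure $dV$, write $|U|$ for the Lebesgue measure of a measurable set $U\subseteq\mathbb H$, and let the Bergman projection $P$ be the orthogonal projection of $L^2(\mathbb H)$ onto its subspace $A^2(\mathbb H)$ of square-integrable holomorphic functions. Since $|\mathbb H|<\infty$, $P$ is defined on $L^4(\mathbb H)\subseteq L^2(\mathbb H)$. Then $P$ is of weak type $(4,4)$, i.e. it is bounded from $L^4(\mathbb H)$ to $L^{4,\infty}(\mathbb H)$: there is a constant $C\ge 0$ such that for every $f\in L^4(\mathbb H)$ and every $\lambda>0$, $$\bigl|\{z\in\mathbb H:|P(f)(z)|>\lambda\}\bigr|\le C\,\frac{\|f\|_{L^4(\mathbb H)}^4}{\lambda^4}.$$ -/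

import Mathlib

open MeasureTheory Set Filter Topology Metric
open scoped ENNReal NNReal

noncomputable section

/-- The space `A²(Ω)` of square-integrable holomorphic functions on an open set `Ω ⊆ ℂ²`, as a
subspace of `L²(Ω)` (with respect to Lebesgue measure): the classes that contain a function which
is holomorphic on `Ω`. -/
def bergmanSpace (Ω : TopologicalSpace.Opens (ℂ × ℂ)) :
    Submodule ℂ (Lp ℂ 2 (volume.restrict (Ω : Set (ℂ × ℂ)))) where
  carrier := {f | ∃ h : ℂ × ℂ → ℂ, DifferentiableOn ℂ h Ω ∧
    f =ᵐ[volume.restrict (Ω : Set (ℂ × ℂ))] h}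
  add_mem' := by
    rintro f g ⟨h, hh, hf⟩ ⟨k, hk, hg⟩
    exact ⟨h + k, hh.add hk, (Lp.coeFn_add f g).trans (hf.add hg)⟩
  zero_mem' := ⟨0, differentiableOn_const 0, Lp.coeFn_zero _ _ _⟩
  smul_mem' := by
    rintro c f ⟨h, hh, hf⟩
    exact ⟨c • h, hh.const_smul c, (Lp.coeFn_smul c f).trans (hf.const_smul c)⟩

namespace BergmanAux

/-- Rotations of `ℂ²` by a common phase preserve integrals over balls around the origin. -/
lemma integral_rotate (F : ℂ × ℂ → ℂ) (r θ : ℝ) :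
    ∫ v in closedBall (0 : ℂ × ℂ) r, F (circleMap 0 1 θ • v) =
      ∫ v in closedBall (0 : ℂ × ℂ) r, F v := by
  have h1 : ‖circleMap 0 1 θ‖ = 1 := by simp
  let a : Circle := ⟨circleMap 0 1 θ, by simp [Submonoid.unitSphere]⟩
  have hm : MeasurePreserving (fun v : ℂ × ℂ => (circleMap 0 1 θ • v : ℂ × ℂ))
      volume volume := by
    have h := (rotation a).measurePreserving
    exact h.prod h
  have he : MeasurableEmbedding (fun v : ℂ × ℂ => (circleMap 0 1 θ • v : ℂ × ℂ)) := by
    have h0 : circleMap 0 1 θ ≠ 0 := by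
      intro h
      rw [h] at h1
      simp at h1
    exact (Homeomorph.smulOfNeZero _ h0).measurableEmbedding
  have h := hm.setIntegral_preimage_emb he F (closedBall 0 r)
  have hs : (fun v : ℂ × ℂ => (circleMap 0 1 θ • v : ℂ × ℂ)) ⁻¹' closedBall 0 r
      = closedBall 0 r := by
    ext v
    simp [norm_smul]
  rw [hs] at h
  exact h

/-- The mean value property over balls in `ℂ²`. -/
lemma mean_value {h : ℂ × ℂ → ℂ} {Ω : Set (ℂ × ℂ)}
    (hh : DifferentiableOn ℂ h Ω) {z : ℂ × ℂ} {r : ℝ} (hr : closedBall z r ⊆ Ω) :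
    ∫ w in closedBall z r, h w = (volume.real (closedBall z r) : ℂ) * h z := by
  have hmem : ∀ v ∈ closedBall (0 : ℂ × ℂ) r, ∀ ζ ∈ closedBall (0 : ℂ) 1, z + ζ • v ∈ Ω := by
    intro v hv ζ hζ
    apply hr
    simp only [mem_closedBall, dist_zero_right, dist_self_add_left] at *
    rw [norm_smul]
    nlinarith [norm_nonneg v, norm_nonneg ζ]
  have hcirc : ∀ v ∈ closedBall (0 : ℂ × ℂ) r,
      ∫ θ in (0 : ℝ)..2 * Real.pi, h (z + circleMap 0 1 θ • v) = (2 * Real.pi : ℝ) • h z := by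
    intro v hv
    have hd : DifferentiableOn ℂ (fun ζ : ℂ => h (z + ζ • v)) (closedBall 0 1) := by
      refine hh.comp ?_ (fun ζ hζ => hmem v hv ζ hζ)
      fun_prop
    have := circleAverage_of_differentiable_on_off_countable (R := 1) (c := 0)
      (f := fun ζ : ℂ => h (z + ζ • v)) (s := ∅) countable_empty
      (by simpa using hd.continuousOn)
      (fun ζ hζ => by
        have hζ' : ζ ∈ ball (0 : ℂ) 1 := by simpa using hζ
        exact (hd ζ (ball_subset_closedBall hζ')).differentiableAt
          (mem_of_superset (isOpen_ball.mem_nhds hζ') ball_subset_closedBall))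
    rw [Real.circleAverage_def] at this
    have hpi : (2 * Real.pi : ℝ) ≠ 0 := by positivity
    rw [inv_smul_eq_iff₀ hpi] at this
    simpa using this
  have hcont : ContinuousOn (fun p : ℝ × (ℂ × ℂ) => h (z + circleMap 0 1 p.1 • p.2))
      (univ ×ˢ closedBall (0 : ℂ × ℂ) r) := by
    refine hh.continuousOn.comp ?_ ?_
    · apply Continuous.continuousOn
      have := continuous_circleMap 0 1
      fun_prop
    · rintro ⟨θ, v⟩ ⟨-, hv⟩
      exact hmem v hv _ (by simp)
  have hint : Integrable (Function.uncurry fun (θ : ℝ) (v : ℂ × ℂ) =>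
      h (z + circleMap 0 1 θ • v))
      ((volume.restrict (uIoc 0 (2 * Real.pi))).prod
        (volume.restrict (closedBall (0 : ℂ × ℂ) r))) := by
    rw [Measure.prod_restrict]
    have hc : IntegrableOn (Function.uncurry fun (θ : ℝ) (v : ℂ × ℂ) =>
        h (z + circleMap 0 1 θ • v))
        (Icc 0 (2 * Real.pi) ×ˢ closedBall (0 : ℂ × ℂ) r) (volume.prod volume) := by
      refine ContinuousOn.integrableOn_compact (isCompact_Icc.prod (isCompact_closedBall _ _)) ?_
      exact hcont.mono (prod_mono (subset_univ _) subset_rfl)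
    refine hc.mono_set (prod_mono ?_ subset_rfl)
    rw [uIoc_of_le (by positivity)]
    exact Ioc_subset_Icc_self
  have hswap := intervalIntegral_integral_swap hint
  have hL : ∀ θ : ℝ, ∫ v in closedBall (0 : ℂ × ℂ) r, h (z + circleMap 0 1 θ • v)
      = ∫ v in closedBall (0 : ℂ × ℂ) r, h (z + v) := fun θ =>
    integral_rotate (fun v => h (z + v)) r θ
  simp only [hL] at hswap
  rw [setIntegral_congr_fun measurableSet_closedBall hcirc] at hswap
  have : (volume : Measure (ℂ × ℂ)).IsAddLeftInvariant :=
    inferInstanceAs (((volume : Measure ℂ).prod (volume : Measure ℂ)).IsAddLeftInvariant)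
  have htr : ∫ v in closedBall (0 : ℂ × ℂ) r, h (z + v) = ∫ w in closedBall z r, h w := by
    have h := (measurePreserving_add_left (volume : Measure (ℂ × ℂ)) z).setIntegral_preimage_emb
      (measurableEmbedding_addLeft z) h (closedBall z r)
    simpa using h
  have hvol : volume.real (closedBall (0 : ℂ × ℂ) r) = volume.real (closedBall z r) := by
    have := (measurePreserving_add_left (volume : Measure (ℂ × ℂ)) z).measure_preimage
      (measurableSet_closedBall (x := z) (ε := r)).nullMeasurableSet
    simp only [preimage_add_closedBall, sub_self] at this
    simp [Measure.real, this]
  rw [htr] at hswap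
  simp only [intervalIntegral.integral_const, sub_zero, integral_const, MeasurableSet.univ,
    measureReal_restrict_apply, univ_inter, hvol] at hswap
  have hpi : (2 * Real.pi : ℝ) ≠ 0 := by positivity
  rw [smul_comm] at hswap
  have := smul_right_injective ℂ hpi hswap
  simpa using this

/-- Point evaluations are bounded on `A²(Ω)`, locally uniformly. -/
lemma point_eval {r : ℝ} (hr0 : 0 < r) : ∃ K : ℝ, 0 < K ∧
    ∀ (Ω : TopologicalSpace.Opens (ℂ × ℂ))
      (f : Lp ℂ 2 (volume.restrict (Ω : Set (ℂ × ℂ)))) (h : ℂ × ℂ → ℂ),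
      DifferentiableOn ℂ h Ω → f =ᵐ[volume.restrict (Ω : Set (ℂ × ℂ))] h →
      ∀ z, closedBall z r ⊆ (Ω : Set (ℂ × ℂ)) → ‖h z‖ ≤ K * ‖f‖ := by
  have : (volume : Measure (ℂ × ℂ)).IsAddLeftInvariant :=
    inferInstanceAs (((volume : Measure ℂ).prod (volume : Measure ℂ)).IsAddLeftInvariant)
  set V := volume.real (closedBall (0 : ℂ × ℂ) r) with hV
  have hVpos : 0 < V := by
    apply ENNReal.toReal_pos
    · exact (measure_closedBall_pos _ _ hr0).ne'
    · exact (isCompact_closedBall _ _).measure_ne_top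
  refine ⟨V⁻¹ * V ^ (1 / (2 : ℝ)), by positivity, ?_⟩
  intro Ω f h hh hf z hz
  have hvol : volume.real (closedBall z r) = V := by
    have := (measurePreserving_add_left (volume : Measure (ℂ × ℂ)) z).measure_preimage
      (measurableSet_closedBall (x := z) (ε := r)).nullMeasurableSet
    simp only [preimage_add_closedBall, sub_self] at this
    simp [hV, Measure.real, this]
  have hmv := mean_value hh hz
  rw [hvol] at hmv
  have hμr : (volume.restrict (Ω : Set (ℂ × ℂ))).restrict (closedBall z r) = volume.restrict (closedBall z r) := by
    rw [Measure.restrict_restrict measurableSet_closedBall, inter_eq_left.mpr hz]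
  have hμV : (volume.restrict (Ω : Set (ℂ × ℂ))).real (closedBall z r) = V := by
    rw [← hvol, measureReal_restrict_apply measurableSet_closedBall, inter_eq_left.mpr hz]
  have hfin : volume.restrict (Ω : Set (ℂ × ℂ)) (closedBall z r) ≠ ∞ := by
    rw [Measure.restrict_apply measurableSet_closedBall, inter_eq_left.mpr hz]
    exact (isCompact_closedBall _ _).measure_ne_top
  have h1 := L2.inner_indicatorConstLp_one (𝕜 := ℂ) measurableSet_closedBall hfin f
  have h2 : ∫ x in closedBall z r, f x ∂(volume.restrict (Ω : Set (ℂ × ℂ))) = ∫ x in closedBall z r, h x := by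
    rw [← hμr]
    exact integral_congr_ae (ae_restrict_of_ae hf)
  rw [h2, hmv] at h1
  have h3 := norm_inner_le_norm (𝕜 := ℂ)
    (indicatorConstLp 2 measurableSet_closedBall hfin (1 : ℂ)) f
  rw [h1, norm_indicatorConstLp (by norm_num) (by norm_num), hμV] at h3
  simp only [norm_mul, Complex.norm_real, Real.norm_eq_abs, abs_of_pos hVpos, norm_one,
    one_mul, ENNReal.toReal_ofNat] at h3
  rw [mul_assoc, ← div_eq_inv_mul, le_div_iff₀ hVpos, mul_comm]
  exact h3

/-- `A²(Ω)` is closed in `L²(Ω)`. -/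
lemma isClosed_bergmanSpace (Ω : TopologicalSpace.Opens (ℂ × ℂ)) :
    IsClosed (bergmanSpace Ω : Set (Lp ℂ 2 (volume.restrict (Ω : Set (ℂ × ℂ))))) := by
  rw [← isSeqClosed_iff_isClosed]
  intro u F hu hF
  choose h hh hf using hu
  have hcau : CauchySeq u := hF.cauchySeq
  have hdiff : ∀ n m, (u n - u m : Lp ℂ 2 (volume.restrict (Ω : Set (ℂ × ℂ))))
      =ᵐ[volume.restrict (Ω : Set (ℂ × ℂ))] h n - h m := fun n m =>
    (Lp.coeFn_sub _ _).trans ((hf n).sub (hf m))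
  have hpt : ∀ z ∈ Ω, CauchySeq fun n => h n z := by
    intro z hz
    obtain ⟨r, hr0, hr⟩ := nhds_basis_closedBall.mem_iff.mp (Ω.isOpen.mem_nhds hz)
    obtain ⟨K, hK, hKb⟩ := point_eval hr0
    rw [Metric.cauchySeq_iff] at hcau ⊢
    intro ε hε
    obtain ⟨N, hN⟩ := hcau (ε / K) (by positivity)
    refine ⟨N, fun m hm n hn => ?_⟩
    have h1 := hKb Ω _ _ ((hh m).sub (hh n)) (hdiff m n) z hr
    have h2 := hN m hm n hn
    rw [dist_eq_norm] at h2 ⊢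
    rw [lt_div_iff₀ hK, mul_comm] at h2
    exact h1.trans_lt h2
  have hlim : ∀ z, ∃ w, z ∈ Ω → Tendsto (fun n => h n z) atTop (𝓝 w) := by
    intro z
    by_cases hz : z ∈ Ω
    · obtain ⟨w, hw⟩ := cauchySeq_tendsto_of_complete (hpt z hz)
      exact ⟨w, fun _ => hw⟩
    · exact ⟨0, fun h => absurd h hz⟩
  choose g hg using hlim
  refine ⟨g, ?_, ?_⟩
  · intro z₀ hz₀
    obtain ⟨R, hR0, hR⟩ := nhds_basis_closedBall.mem_iff.mp (Ω.isOpen.mem_nhds hz₀)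
    set r := R / 3 with hr
    have hr0 : 0 < r := by positivity
    obtain ⟨K, hK, hKb⟩ := point_eval hr0
    have hsub : ∀ z ∈ ball z₀ r, ∀ w ∈ ball z r, closedBall w r ⊆ (Ω : Set (ℂ × ℂ)) := by
      intro z hz w hw x hx
      apply hR
      rw [mem_ball] at hz hw
      rw [mem_closedBall] at hx ⊢
      linarith [dist_triangle x w z₀, dist_triangle w z z₀]
    have hsub' : ∀ z ∈ ball z₀ r, z ∈ Ω := fun z hz =>
      hsub z hz z (mem_ball_self hr0) (mem_closedBall_self hr0.le)
    have hdat : ∀ n, ∀ z ∈ ball z₀ r, DifferentiableAt ℂ (h n) z := fun n z hz =>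
      (hh n z (hsub' z hz)).differentiableAt (Ω.isOpen.mem_nhds (hsub' z hz))
    have hest : ∀ n m, ∀ z ∈ ball z₀ r,
        ‖fderiv ℂ (h n) z - fderiv ℂ (h m) z‖ ≤ 2 * K / r * ‖u n - u m‖ := by
      intro n m z hz
      have hb : ∀ w ∈ ball z r, ‖(h n - h m) w‖ ≤ K * ‖u n - u m‖ := fun w hw =>
        hKb Ω _ _ ((hh n).sub (hh m)) (hdiff n m) w (hsub z hz w hw)
      have h1 := Complex.norm_fderiv_le_div_of_mapsTo_ball (f := h n - h m) (c := z) (R₁ := r)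
        (R₂ := 2 * (K * ‖u n - u m‖))
        (((hh n).sub (hh m)).mono fun w hw =>
          hsub z hz w hw (mem_closedBall_self hr0.le))
        (fun w hw => by
          rw [mem_closedBall, dist_eq_norm]
          linarith [norm_sub_le ((h n - h m) w) ((h n - h m) z), hb w hw,
            hb z (mem_ball_self hr0)]) hr0
      rw [fderiv_sub (hdat n z hz) (hdat m z hz)] at h1
      calc _ ≤ _ := h1
        _ = _ := by ring
    have huc : UniformCauchySeqOn (fun n => fderiv ℂ (h n)) atTop (ball z₀ r) := by
      rw [Metric.uniformCauchySeqOn_iff]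
      intro ε hε
      rw [Metric.cauchySeq_iff] at hcau
      obtain ⟨N, hN⟩ := hcau (ε / (2 * K / r)) (by positivity)
      refine ⟨N, fun m hm n hn z hz => ?_⟩
      have h2 := hN m hm n hn
      rw [dist_eq_norm] at h2 ⊢
      rw [lt_div_iff₀ (by positivity), mul_comm] at h2
      exact (hest m n z hz).trans_lt h2
    have hlim' : ∀ z, ∃ w, z ∈ ball z₀ r → Tendsto (fun n => fderiv ℂ (h n) z) atTop (𝓝 w) := by
      intro z
      by_cases hz : z ∈ ball z₀ r
      · obtain ⟨w, hw⟩ := cauchySeq_tendsto_of_complete (huc.cauchySeq hz)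
        exact ⟨w, fun _ => hw⟩
      · exact ⟨0, fun h => absurd h hz⟩
    choose g' hg' using hlim'
    have hmain := hasFDerivAt_of_tendstoUniformlyOn (g := g) isOpen_ball
      (huc.tendstoUniformlyOn_of_tendsto hg') (fun n z hz => (hdat n z hz).hasFDerivAt)
      (fun z hz => hg z (hsub' z hz)) (mem_ball_self hr0)
    exact hmain.differentiableAt.differentiableWithinAt
  · obtain ⟨ns, hns, hae⟩ := (tendstoInMeasure_of_tendsto_Lp hF).exists_seq_tendsto_ae
    filter_upwards [hae, ae_all_iff.mpr hf, ae_restrict_mem Ω.isOpen.measurableSet]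
      with z h1 h2 h3
    simp only [h2] at h1
    exact tendsto_nhds_unique h1 ((hg z h3).comp hns.tendsto_atTop)

end BergmanAux

instance (Ω : TopologicalSpace.Opens (ℂ × ℂ)) : CompleteSpace (bergmanSpace Ω) :=
  (BergmanAux.isClosed_bergmanSpace Ω).completeSpace_coe

/-- The Bergman projection of `Ω`: the orthogonal projection of `L²(Ω)` onto `A²(Ω)`. -/
def bergmanProjection (Ω : TopologicalSpace.Opens (ℂ × ℂ)) :
    Lp ℂ 2 (volume.restrict (Ω : Set (ℂ × ℂ))) →L[ℂ]
      Lp ℂ 2 (volume.restrict (Ω : Set (ℂ × ℂ))) :=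
  (bergmanSpace Ω).starProjection

/-- The Bergman projection on `L^p(Ω)` for `p ≥ 2` and `Ω` of finite volume, through the
inclusion `L^p(Ω) ⊆ L²(Ω)`. Its values are regarded as measurable functions on `Ω` modulo
equality almost everywhere. -/
def bergmanProjectionLp (Ω : TopologicalSpace.Opens (ℂ × ℂ))
    [IsFiniteMeasure (volume.restrict (Ω : Set (ℂ × ℂ)))] {p : ℝ≥0∞} (hp : 2 ≤ p)
    (f : Lp ℂ p (volume.restrict (Ω : Set (ℂ × ℂ)))) :
    (ℂ × ℂ) →ₘ[volume.restrict (Ω : Set (ℂ × ℂ))] ℂ :=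
  (bergmanProjection Ω (((Lp.memLp f).mono_exponent hp).toLp f) :
    Lp ℂ 2 (volume.restrict (Ω : Set (ℂ × ℂ))))

/-- An operator `T` from `L^p(X, μ)` to measurable functions on `(Y, ν)` is of weak type `(p, q)`
if it is bounded from `L^p(X, μ)` to `L^{q,∞}(Y, ν)`: there is a constant `C` such that
`ν {|T f| > t} ≤ C ‖f‖_p ^ q / t ^ q` for all `f ∈ L^p(X, μ)` and all `t > 0`. -/
def IsWeakType {X Y : Type*} [MeasurableSpace X] [MeasurableSpace Y] {μ : Measure X}
    {ν : Measure Y} (p : ℝ≥0∞) (q : ℝ) (T : Lp ℂ p μ → (Y →ₘ[ν] ℂ)) : Prop :=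
  ∃ C : ℝ≥0, ∀ f : Lp ℂ p μ, ∀ t : ℝ, 0 < t →
    ν {y | t < ‖T f y‖} ≤ C * eLpNorm f p μ ^ q / ENNReal.ofReal t ^ q

/-- The Hartogs triangle `{(z₁, z₂) ∈ ℂ² : |z₁| < |z₂| < 1}`. -/
def hartogsTriangle : TopologicalSpace.Opens (ℂ × ℂ) where
  carrier := {z | ‖z.1‖ < ‖z.2‖ ∧ ‖z.2‖ < 1}
  is_open' := by
    refine IsOpen.and (isOpen_lt ?_ ?_) (isOpen_lt ?_ ?_) <;> fun_prop

instance : IsFiniteMeasure (volume.restrict (hartogsTriangle : Set (ℂ × ℂ))) := by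
  refine isFiniteMeasure_restrict.mpr (Bornology.IsBounded.measure_lt_top ?_).ne
  refine (isBounded_closedBall (x := (0 : ℂ × ℂ)) (r := 1)).subset (fun z hz => ?_)
  obtain ⟨h1, h2⟩ : ‖z.1‖ < ‖z.2‖ ∧ ‖z.2‖ < 1 := hz
  simp only [mem_closedBall, dist_zero_right, Prod.norm_def]
  exact max_le (h1.trans h2).le h2.le

end

/-! ### Polar coordinates on the unit disc -/

namespace BergmanDisc

/-! The map `(w, z) ↦ (w z, z)` carries `dA(w) ⊗ |z|² dA(z)` on `𝔻 × 𝔻*` to Lebesgue measure on the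
Hartogs triangle. If `h ∈ A²`, then `z h(w z, z)` is holomorphic on `𝔻 × 𝔻*` and square-integrable
for the unweighted measure. Its singularity at `z = 0` is therefore removable on almost every slice,
and the product of two disc Bergman kernels reproduces it. So in these coordinates `|z| |P f|` is at
most `B_z(|ζ| B_w |f|)`, where `B` is the operator whose kernel is the modulus of the disc kernel
(`integral_conj_hartogsKernel_mul`, `enorm_bergmanProjection_hartogs_le`).

In `w` nothing is lost: `B` is bounded on `L⁴(𝔻)` by Schur's test with the Forelli–Rudin estimates
(`exists_lintegral_absBergman_pow_four_le`).

The obstruction is the factor `1/|z|` in the other variable. It lies in weak `L⁴(|z|² dA)` but not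
in `L⁴`, so `4` is the critical exponent. Away from `0` the factor is bounded, and Chebyshev's
inequality with the strong bound for `B` is enough. Near `0` the kernel is bounded, so `B(|ζ| u)` is
at most a constant multiple of `∫ |ζ| u`, and the weak norm of `1/|z|` finishes
(`exists_weightedDiscMeasure_lt_absBergman_le`). Integrating this slice estimate over `w` and
applying the strong bound in `w` gives the result (`exists_prod_lt_absBergman_le`). -/

theorem polarCoord_symm_eq_circleMap (p : ℝ × ℝ) :
    Complex.polarCoord.symm p = circleMap 0 p.1 p.2 := by
  simp [circleMap, Complex.exp_mul_I]

theorem setLIntegral_unitDisc_polar {f : ℂ → ℝ≥0∞} (hf : Measurable f) :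
    ∫⁻ z in ball (0 : ℂ) 1, f z =
      ∫⁻ r in Ioo (0 : ℝ) 1, ENNReal.ofReal r *
        ∫⁻ θ in Ioo (-Real.pi) Real.pi, f (circleMap 0 r θ) := by
  have hmap : Measurable fun p : ℝ × ℝ => circleMap 0 p.1 p.2 := by
    unfold circleMap; fun_prop
  rw [← lintegral_indicator measurableSet_ball, ← Complex.lintegral_comp_polarCoord_symm]
  simp only [polarCoord_symm_eq_circleMap, smul_eq_mul]
  have h1 : ∀ p ∈ polarCoord.target, ENNReal.ofReal p.1 *
      (ball (0 : ℂ) 1).indicator f (circleMap 0 p.1 p.2) =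
      (Iio (1 : ℝ) ×ˢ (univ : Set ℝ)).indicator
        (fun p : ℝ × ℝ => ENNReal.ofReal p.1 * f (circleMap 0 p.1 p.2)) p := by
    rintro ⟨r, θ⟩ hp
    have hr : 0 < r := hp.1
    by_cases h : r < 1
    · rw [indicator_of_mem (by simpa [abs_of_pos hr] using h), indicator_of_mem (by simpa using h)]
    · rw [indicator_of_notMem (by simpa [abs_of_pos hr] using h),
        indicator_of_notMem (by simpa using h), mul_zero]
  rw [setLIntegral_congr_fun polarCoord.open_target.measurableSet h1,
    setLIntegral_indicator (measurableSet_Iio.prod MeasurableSet.univ)]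
  have h2 : (Iio (1 : ℝ) ×ˢ (univ : Set ℝ)) ∩ polarCoord.target =
      Ioo (0 : ℝ) 1 ×ˢ Ioo (-Real.pi) Real.pi := by
    ext ⟨r, θ⟩
    simp only [polarCoord_target, mem_inter_iff, mem_prod, mem_Iio, mem_univ, and_true, mem_Ioi,
      mem_Ioo]
    tauto
  rw [h2, Measure.volume_eq_prod, setLIntegral_prod _ (by fun_prop)]
  refine lintegral_congr fun r => ?_
  simp only
  rw [lintegral_const_mul _ (by fun_prop)]

/-- The angle is moved to `[0, 2π]` by periodicity, so that circle integrals and circle averages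
apply directly. -/
theorem setIntegral_unitDisc_polar {f : ℂ → ℂ} (hc : ContinuousOn f (ball 0 1))
    (hf : IntegrableOn f (ball 0 1)) :
    ∫ z in ball (0 : ℂ) 1, f z =
      ∫ r in (0 : ℝ)..1, (r : ℂ) * ∫ θ in (0 : ℝ)..2 * Real.pi, f (circleMap 0 r θ) := by
  have hmap : Continuous fun p : ℝ × ℝ => circleMap 0 p.1 p.2 := by
    unfold circleMap; fun_prop
  have h2 : (Iio (1 : ℝ) ×ˢ (univ : Set ℝ)) ∩ polarCoord.target =
      Ioo (0 : ℝ) 1 ×ˢ Ioo (-Real.pi) Real.pi := by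
    ext ⟨r, θ⟩
    simp only [polarCoord_target, mem_inter_iff, mem_prod, mem_Iio, mem_univ, and_true, mem_Ioi,
      mem_Ioo]
    tauto
  have hms : MeasurableSet (Ioo (0 : ℝ) 1 ×ˢ Ioo (-Real.pi) Real.pi) :=
    measurableSet_Ioo.prod measurableSet_Ioo
  have h1 : ∀ p ∈ polarCoord.target, p.1 •
      (ball (0 : ℂ) 1).indicator f (circleMap 0 p.1 p.2) =
      (Iio (1 : ℝ) ×ˢ (univ : Set ℝ)).indicator
        (fun p : ℝ × ℝ => p.1 • f (circleMap 0 p.1 p.2)) p := by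
    rintro ⟨r, θ⟩ hp
    have hr : 0 < r := hp.1
    by_cases h : r < 1
    · rw [indicator_of_mem (by simpa [abs_of_pos hr] using h), indicator_of_mem (by simpa using h)]
    · rw [indicator_of_notMem (by simpa [abs_of_pos hr] using h),
        indicator_of_notMem (by simpa using h), smul_zero]
  have hint : IntegrableOn (fun p : ℝ × ℝ => p.1 • f (circleMap 0 p.1 p.2))
      (Ioo (0 : ℝ) 1 ×ˢ Ioo (-Real.pi) Real.pi) (volume.prod volume) := by
    refine ⟨ContinuousOn.aestronglyMeasurable ?_ hms, ?_⟩
    · refine continuousOn_fst.smul (hc.comp hmap.continuousOn ?_)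
      rintro ⟨r, θ⟩ ⟨hr, -⟩
      simpa [abs_of_pos hr.1] using hr.2
    · have := hf.2
      rw [HasFiniteIntegral, ← lintegral_indicator measurableSet_ball,
        ← Complex.lintegral_comp_polarCoord_symm] at this
      rw [HasFiniteIntegral]
      refine lt_of_le_of_lt ?_ this
      rw [← Measure.volume_eq_prod]
      refine (setLIntegral_mono' hms ?_).trans (lintegral_mono_set (h2 ▸ inter_subset_right))
      rintro ⟨r, θ⟩ ⟨hr, -⟩
      simp only [polarCoord_symm_eq_circleMap]
      rw [indicator_of_mem (by simpa [abs_of_pos hr.1] using hr.2), enorm_smul,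
        Real.enorm_eq_ofReal hr.1.le, smul_eq_mul]
  rw [← integral_indicator measurableSet_ball, ← Complex.integral_comp_polarCoord_symm]
  simp only [polarCoord_symm_eq_circleMap]
  rw [setIntegral_congr_fun polarCoord.open_target.measurableSet h1,
    setIntegral_indicator (measurableSet_Iio.prod MeasurableSet.univ), inter_comm,
    h2, Measure.volume_eq_prod, setIntegral_prod _ hint,
    intervalIntegral.integral_of_le zero_le_one, integral_Ioc_eq_integral_Ioo]
  refine integral_congr_ae (Eventually.of_forall fun r => ?_)
  simp only [integral_smul]
  rw [← integral_Ioc_eq_integral_Ioo, ← intervalIntegral.integral_of_le (by linarith [Real.pi_pos])]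
  have hp : Function.Periodic (fun θ => f (circleMap 0 r θ)) (2 * Real.pi) := fun θ => by
    simp only [periodic_circleMap 0 r θ]
  have := hp.intervalIntegral_add_eq (-Real.pi) 0
  rw [show -Real.pi + 2 * Real.pi = Real.pi by ring, zero_add] at this
  rw [this, Complex.real_smul]

/-! ### The reproducing property of the Bergman kernel of the disc -/

theorem one_sub_mul_conj_ne_zero {z ζ : ℂ} (hz : ‖z‖ < 1) (hζ : ‖ζ‖ < 1) :
    1 - z * (starRingEnd ℂ) ζ ≠ 0 := by
  intro h
  have h1 : ‖z * (starRingEnd ℂ) ζ‖ = 1 := by rw [← sub_eq_zero.mp h, norm_one]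
  rw [norm_mul, RCLike.norm_conj] at h1
  nlinarith [norm_nonneg z, norm_nonneg ζ]

theorem le_norm_one_sub_mul_conj (z : ℂ) {ζ : ℂ} (hζ : ‖ζ‖ ≤ 1) :
    1 - ‖z‖ ≤ ‖1 - z * (starRingEnd ℂ) ζ‖ := by
  have h1 := norm_sub_norm_le (1 : ℂ) (z * (starRingEnd ℂ) ζ)
  rw [norm_mul, RCLike.norm_conj, norm_one] at h1
  nlinarith [norm_nonneg z, norm_nonneg ζ]

theorem continuousOn_kernel {z : ℂ} (hz : ‖z‖ < 1) :
    ContinuousOn (fun ζ : ℂ => ((1 - z * (starRingEnd ℂ) ζ) ^ 2)⁻¹) (ball 0 1) := by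
  refine ContinuousOn.inv₀ (Continuous.continuousOn ?_) fun ζ hζ =>
    pow_ne_zero 2 (one_sub_mul_conj_ne_zero hz (by simpa using hζ))
  have := Complex.continuous_conj
  fun_prop

theorem integrableOn_kernel_mul {h : ℂ → ℂ} (hi : IntegrableOn h (ball 0 1)) {z : ℂ}
    (hz : ‖z‖ < 1) :
    IntegrableOn (fun ζ => ((1 - z * (starRingEnd ℂ) ζ) ^ 2)⁻¹ * h ζ) (ball 0 1) := by
  refine Integrable.bdd_mul (c := ((1 - ‖z‖) ^ 2)⁻¹) hi
    ((continuousOn_kernel hz).aestronglyMeasurable measurableSet_ball) ?_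
  filter_upwards [ae_restrict_mem measurableSet_ball] with ζ hζ
  rw [norm_inv, norm_pow]
  have h1 := le_norm_one_sub_mul_conj z (ζ := ζ) (by simpa using (mem_ball_zero_iff.mp hζ).le)
  have h2 : 0 < 1 - ‖z‖ := by linarith
  gcongr

/-- On `|ζ| = r` one has `conj ζ = r²/ζ`, so the kernel equals `ζ²/(ζ - z r²)²`. With `dζ = i ζ dθ`
the integral is Cauchy's formula for the derivative of `ζ h(ζ)` at `z r²`. -/
theorem circle_integral_kernel {h : ℂ → ℂ} (hh : DifferentiableOn ℂ h (ball 0 1)) {z : ℂ}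
    (hz : ‖z‖ < 1) {r : ℝ} (hr0 : 0 < r) (hr1 : r < 1) :
    ∫ θ in (0 : ℝ)..2 * Real.pi, ((1 - z * (starRingEnd ℂ) (circleMap 0 r θ)) ^ 2)⁻¹ *
      h (circleMap 0 r θ) = 2 * Real.pi * deriv (fun ζ => ζ * h ζ) (z * r ^ 2) := by
  have hw : z * (r : ℂ) ^ 2 ∈ ball (0 : ℂ) r := by
    simp only [mem_ball_zero_iff, norm_mul, norm_pow, Complex.norm_real, Real.norm_eq_abs,
      abs_of_pos hr0]
    nlinarith [norm_nonneg z]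
  have hC := Complex.two_pi_I_inv_smul_circleIntegral_sub_sq_inv_smul_of_differentiable
    (isOpen_ball (x := (0 : ℂ)) (ε := 1)) (closedBall_subset_ball hr1)
    (differentiableOn_id.mul hh) hw
  rw [inv_smul_eq_iff₀ Complex.two_pi_I_ne_zero, circleIntegral] at hC
  have hD : (fun ζ => ζ * h ζ) = id * h := rfl
  have hE : ∀ θ : ℝ, deriv (circleMap 0 r) θ • ((circleMap 0 r θ - z * (r : ℂ) ^ 2) ^ 2)⁻¹ •
      (id * h : ℂ → ℂ) (circleMap 0 r θ) = Complex.I * (((1 - z * (starRingEnd ℂ) (circleMap 0 r θ)) ^ 2)⁻¹ *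
      h (circleMap 0 r θ)) := by
    intro θ
    have hne : circleMap 0 r θ ≠ 0 := circleMap_ne_center hr0.ne'
    have h1 : circleMap 0 r θ * (starRingEnd ℂ) (circleMap 0 r θ) = (r : ℂ) ^ 2 := by
      rw [Complex.mul_conj']; simp [abs_of_pos hr0]
    have h2 : circleMap 0 r θ - z * (r : ℂ) ^ 2 =
        circleMap 0 r θ * (1 - z * (starRingEnd ℂ) (circleMap 0 r θ)) := by
      rw [← h1]; ring
    have h3 := one_sub_mul_conj_ne_zero (ζ := circleMap 0 r θ) hz (by simpa [abs_of_pos hr0])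
    rw [h2, deriv_circleMap]
    simp only [smul_eq_mul, Pi.mul_apply, id]
    field_simp
  simp only [hE] at hC
  rw [intervalIntegral.integral_const_mul, smul_eq_mul] at hC
  rw [hD]
  apply mul_left_cancel₀ Complex.I_ne_zero
  rw [hC]; ring

/-- The weighted Bergman kernel reproduces integrable holomorphic functions on the disc. -/
theorem integral_kernel_mul {h : ℂ → ℂ} (hh : DifferentiableOn ℂ h (ball 0 1))
    (hi : IntegrableOn h (ball 0 1)) {z : ℂ} (hz : ‖z‖ < 1) (hz0 : z ≠ 0) :
    ∫ ζ in ball (0 : ℂ) 1, ((1 - z * (starRingEnd ℂ) ζ) ^ 2)⁻¹ * h ζ = Real.pi * h z := by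
  rw [setIntegral_unitDisc_polar
    (f := fun ζ => ((1 - z * (starRingEnd ℂ) ζ) ^ 2)⁻¹ * h ζ)
    ((continuousOn_kernel hz).mul hh.continuousOn) (integrableOn_kernel_mul hi hz)]
  set G : ℂ → ℂ := fun ζ => ζ * h ζ with hG
  have hGd : DifferentiableOn ℂ G (ball 0 1) := differentiableOn_id.mul hh
  have hmem : ∀ r ∈ Icc (0 : ℝ) 1, z * (r : ℂ) ^ 2 ∈ ball (0 : ℂ) 1 := by
    intro r hr
    simp only [mem_ball_zero_iff, norm_mul, norm_pow, Complex.norm_real, Real.norm_eq_abs,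
      abs_of_nonneg hr.1]
    have : r ^ 2 ≤ 1 := by nlinarith [hr.1, hr.2]
    nlinarith [norm_nonneg z]
  have hcongr : ∫ r in (0 : ℝ)..1, (r : ℂ) * ∫ θ in (0 : ℝ)..2 * Real.pi,
      ((1 - z * (starRingEnd ℂ) (circleMap 0 r θ)) ^ 2)⁻¹ * h (circleMap 0 r θ) =
      ∫ r in (0 : ℝ)..1, (r : ℂ) * (2 * Real.pi * deriv G (z * r ^ 2)) := by
    rw [intervalIntegral.integral_of_le zero_le_one, intervalIntegral.integral_of_le zero_le_one,
      integral_Ioc_eq_integral_Ioo, integral_Ioc_eq_integral_Ioo]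
    refine setIntegral_congr_fun measurableSet_Ioo fun r hr => ?_
    rw [circle_integral_kernel hh hz hr.1 hr.2]
  rw [hcongr]
  -- The radial integrand is an exact derivative. The primitive divides by `z`, hence the
  -- requirement `z ≠ 0`; it vanishes at `r = 0` and equals `π h(z)` at `r = 1`.
  have hderiv : ∀ r ∈ uIcc (0 : ℝ) 1, HasDerivAt (fun r : ℝ => Real.pi / z * G (z * (r : ℂ) ^ 2))
      ((r : ℂ) * (2 * Real.pi * deriv G (z * r ^ 2))) r := by
    intro r hr
    rw [uIcc_of_le zero_le_one] at hr
    have h1 : HasDerivAt G (deriv G (z * (r : ℂ) ^ 2)) (z * (r : ℂ) ^ 2) :=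
      (hGd.differentiableAt (isOpen_ball.mem_nhds (hmem r hr))).hasDerivAt
    have h2 : HasDerivAt (fun w : ℂ => z * w ^ 2) (z * (2 * (r : ℂ))) (r : ℂ) := by
      simpa using (hasDerivAt_pow 2 (r : ℂ)).const_mul z
    have h3 := ((HasDerivAt.comp (r : ℂ) h1 h2).const_mul (Real.pi / z)).comp_ofReal
    convert! h3 using 1
    field_simp
  have hcont : ContinuousOn (fun r : ℝ => (r : ℂ) * (2 * Real.pi * deriv G (z * r ^ 2)))
      (uIcc (0 : ℝ) 1) := by
    rw [uIcc_of_le zero_le_one]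
    have h1 := (hGd.deriv isOpen_ball).continuousOn
    have h2 : ContinuousOn (fun r : ℝ => deriv G (z * (r : ℂ) ^ 2)) (Icc (0 : ℝ) 1) :=
      h1.comp (Continuous.continuousOn (by fun_prop)) hmem
    have h3 : ContinuousOn (fun r : ℝ => (r : ℂ)) (Icc (0 : ℝ) 1) :=
      Complex.continuous_ofReal.continuousOn
    exact h3.mul (continuousOn_const.mul h2)
  rw [intervalIntegral.integral_eq_sub_of_hasDerivAt hderiv hcont.intervalIntegrable]
  simp only [hG]
  simp
  field_simp

/-! ### Removable singularities of square-integrable holomorphic functions -/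

/-- Hölder's inequality raised to the power `p`, using `p / q = p - 1`. This is the form that
Schur's test uses. -/
theorem lintegral_rpow_mul_le {α : Type*} [MeasurableSpace α] {μ : Measure α} {p q : ℝ}
    (hpq : p.HolderConjugate q) {f g : α → ℝ≥0∞} (hf : AEMeasurable f μ) (hg : AEMeasurable g μ) :
    (∫⁻ a, f a * g a ∂μ) ^ p ≤ (∫⁻ a, f a ^ p ∂μ) * (∫⁻ a, g a ^ q ∂μ) ^ (p - 1) := by
  have h := ENNReal.lintegral_mul_le_Lp_mul_Lq μ hpq hf hg
  have hp := hpq.pos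
  have hq := hpq.symm.pos
  calc (∫⁻ a, f a * g a ∂μ) ^ p
      ≤ ((∫⁻ a, f a ^ p ∂μ) ^ (1 / p) * (∫⁻ a, g a ^ q ∂μ) ^ (1 / q)) ^ p :=
        ENNReal.rpow_le_rpow h hp.le
    _ = _ := by
        rw [ENNReal.mul_rpow_of_nonneg _ _ hp.le, ← ENNReal.rpow_mul, ← ENNReal.rpow_mul,
          one_div_mul_cancel hp.ne', ENNReal.rpow_one]
        congr 2
        have := hpq.inv_add_inv_eq_one
        rw [one_div, eq_sub_of_add_eq' this]
        field_simp

theorem lintegral_rpow_le {α : Type*} [MeasurableSpace α] {μ : Measure α} {p : ℝ} (hp : 1 < p)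
    {f : α → ℝ≥0∞} (hf : AEMeasurable f μ) :
    (∫⁻ a, f a ∂μ) ^ p ≤ (∫⁻ a, f a ^ p ∂μ) * μ univ ^ (p - 1) := by
  simpa using lintegral_rpow_mul_le (μ := μ) (Real.HolderConjugate.conjExponent hp) hf
    (g := fun _ => 1) aemeasurable_const

/-- Over `ℝ`, multiplication by `a` has determinant equal to the field norm `|a|²`. -/
theorem map_mul_left_volume {a : ℂ} (ha : a ≠ 0) :
    Measure.map (fun ζ : ℂ => a * ζ) volume = ENNReal.ofReal (‖a‖ ^ 2)⁻¹ • volume := by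
  have h1 : LinearMap.det (Algebra.lmul ℝ ℂ a) = ‖a‖ ^ 2 := by
    rw [← Algebra.norm_apply, Algebra.norm_complex_apply, Complex.normSq_eq_norm_sq]
  have h2 : ‖a‖ ^ 2 ≠ 0 := by simpa using ha
  have h := Measure.map_linearMap_addHaar_eq_smul_addHaar (volume : Measure ℂ)
    (f := Algebra.lmul ℝ ℂ a) (by rwa [h1])
  rw [h1, abs_of_nonneg (by positivity)] at h
  exact h

theorem setLIntegral_ball_comp_mul {a : ℂ} (ha : a ≠ 0) (b : ℂ) (F : ℂ → ℝ≥0∞) :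
    ∫⁻ ζ in ball b ‖a‖, F ζ = ENNReal.ofReal (‖a‖ ^ 2) * ∫⁻ ζ in ball (0 : ℂ) 1, F (b + a * ζ) := by
  have hpos : 0 < ‖a‖ := norm_pos_iff.mpr ha
  have he : MeasurableEmbedding (fun ζ : ℂ => a * ζ) :=
    (Homeomorph.mulLeft₀ a ha).measurableEmbedding
  have h1 : ∫⁻ ζ in ball (0 : ℂ) 1, F (b + a * ζ) =
      ∫⁻ ζ, (ball (0 : ℂ) ‖a‖).indicator (fun ζ => F (b + ζ)) (a * ζ) := by
    rw [← lintegral_indicator measurableSet_ball]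
    refine lintegral_congr fun ζ => ?_
    simp only [indicator, mem_ball_zero_iff, norm_mul]
    simp only [mul_lt_iff_lt_one_right hpos]
  have h2 : ∫⁻ ζ in ball b ‖a‖, F ζ =
      ∫⁻ ζ, (ball (0 : ℂ) ‖a‖).indicator (fun ζ => F (b + ζ)) ζ := by
    rw [← lintegral_indicator measurableSet_ball, ← lintegral_add_left_eq_self _ b]
    refine lintegral_congr fun ζ => ?_
    simp [indicator]
  rw [h1, h2, ← he.lintegral_map, map_mul_left_volume ha, lintegral_smul_measure, smul_eq_mul,
    ← mul_assoc, ← ENNReal.ofReal_mul (by positivity), mul_inv_cancel₀ (by positivity),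
    ENNReal.ofReal_one, one_mul]

/-- The mean value property on each circle, integrated against `r dr`. This is the case `z = 0` left
out of `integral_kernel_mul`. -/
theorem integral_unitDisc_eq {h : ℂ → ℂ} (hh : DifferentiableOn ℂ h (ball 0 1))
    (hi : IntegrableOn h (ball 0 1)) : ∫ ζ in ball (0 : ℂ) 1, h ζ = Real.pi * h 0 := by
  rw [setIntegral_unitDisc_polar hh.continuousOn hi]
  have hcongr : ∫ r in (0 : ℝ)..1, (r : ℂ) * ∫ θ in (0 : ℝ)..2 * Real.pi, h (circleMap 0 r θ) =
      ∫ r in (0 : ℝ)..1, (r : ℂ) * (2 * Real.pi * h 0) := by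
    rw [intervalIntegral.integral_of_le zero_le_one, intervalIntegral.integral_of_le zero_le_one,
      integral_Ioc_eq_integral_Ioo, integral_Ioc_eq_integral_Ioo]
    refine setIntegral_congr_fun measurableSet_Ioo fun r hr => ?_
    have hsub : closedBall (0 : ℂ) |r| ⊆ ball 0 1 := closedBall_subset_ball (by
      rw [abs_of_pos hr.1]; exact hr.2)
    have := circleAverage_of_differentiable_on_off_countable (R := r) (c := 0) (f := h)
      (s := ∅) countable_empty (hh.continuousOn.mono hsub) (fun ζ hζ => hh.differentiableAt
        (isOpen_ball.mem_nhds (hsub (ball_subset_closedBall hζ.1))))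
    rw [Real.circleAverage_def, inv_smul_eq_iff₀ (by positivity)] at this
    simp only [this]
    simp
  rw [hcongr, intervalIntegral.integral_mul_const]
  have : ∫ r in (0 : ℝ)..1, (r : ℂ) = 1 / 2 := by
    rw [intervalIntegral.integral_ofReal]; simp
  rw [this]; ring

/-- Mean value property plus Cauchy–Schwarz. If the right side is infinite there is nothing to
prove, so no integrability is assumed. -/
theorem pi_mul_sq_enorm_zero_le {h : ℂ → ℂ} (hh : DifferentiableOn ℂ h (ball 0 1)) :
    ENNReal.ofReal Real.pi * ‖h 0‖ₑ ^ 2 ≤ ∫⁻ ζ in ball (0 : ℂ) 1, ‖h ζ‖ₑ ^ 2 := by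
  have hm : AEStronglyMeasurable h (volume.restrict (ball 0 1)) :=
    hh.continuousOn.aestronglyMeasurable measurableSet_ball
  by_cases htop : ∫⁻ ζ in ball (0 : ℂ) 1, ‖h ζ‖ₑ ^ 2 = ∞
  · rw [htop]; exact le_top
  have hvol : (volume.restrict (ball (0 : ℂ) 1)) univ = ENNReal.ofReal Real.pi := by
    rw [Measure.restrict_apply_univ, Complex.volume_ball]
    rw [ENNReal.ofReal_one, one_pow, one_mul, ← NNReal.coe_real_pi, ENNReal.ofReal_coe_nnreal]
  have hfin : IsFiniteMeasure (volume.restrict (ball (0 : ℂ) 1)) := ⟨by rw [hvol]; simp⟩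
  have hCS := lintegral_rpow_le (μ := volume.restrict (ball (0 : ℂ) 1)) one_lt_two hm.enorm
  rw [hvol] at hCS
  norm_num at hCS
  have hi : IntegrableOn h (ball 0 1) := by
    refine ⟨hm, ?_⟩
    rw [HasFiniteIntegral]
    by_contra hcon
    rw [not_lt, top_le_iff] at hcon
    rw [hcon] at hCS
    refine absurd hCS (not_le.mpr ?_)
    simpa using ENNReal.mul_lt_top (lt_top_iff_ne_top.mpr htop)
      (ENNReal.ofReal_lt_top (r := Real.pi))
  have h1 : ENNReal.ofReal Real.pi * ‖h 0‖ₑ ≤ ∫⁻ ζ in ball (0 : ℂ) 1, ‖h ζ‖ₑ := by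
    have := enorm_integral_le_lintegral_enorm (μ := volume.restrict (ball (0 : ℂ) 1)) h
    rw [integral_unitDisc_eq hh hi, enorm_mul] at this
    rwa [show ‖(Real.pi : ℂ)‖ₑ = ENNReal.ofReal Real.pi by
      rw [← ofReal_norm, Complex.norm_real, Real.norm_of_nonneg Real.pi_pos.le]] at this
  have h2 := (pow_le_pow_left' h1 2).trans hCS
  rw [mul_comm (∫⁻ ζ in ball (0 : ℂ) 1, ‖h ζ‖ₑ ^ 2), mul_pow, sq (ENNReal.ofReal Real.pi),
    mul_assoc] at h2
  exact (ENNReal.mul_le_mul_iff_right (by simp [Real.pi_pos]) (by simp)).mp h2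

/-- Square-integrable holomorphic functions on a punctured disc satisfy `h(z) = o(1/z)`. -/
theorem isLittleO_inv_of_sq_integrable {h : ℂ → ℂ} (hh : DifferentiableOn ℂ h (ball 0 1 \ {0}))
    (hi : ∫⁻ ζ in ball (0 : ℂ) 1, ‖h ζ‖ₑ ^ 2 ≠ ∞) :
    h =o[𝓝[≠] 0] fun z => z⁻¹ := by
  -- The disc of radius `|z|/2` about `z` misses the puncture and, since `|z| < 1/2`, stays inside
  -- the unit disc. Its area `π |z|²/4` produces the constant.
  have hbound : ∀ z : ℂ, z ≠ 0 → ‖z‖ < 1 / 2 →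
      ENNReal.ofReal (Real.pi / 4) * ‖z * h z‖ₑ ^ 2 ≤
        ∫⁻ ζ in ball (0 : ℂ) (2 * ‖z‖), ‖h ζ‖ₑ ^ 2 ∂(volume.restrict (ball (0 : ℂ) 1)) := by
    intro z hz hz2
    have hpos : 0 < ‖z‖ := norm_pos_iff.mpr hz
    have hz' : z / 2 ≠ 0 := by simpa using hz
    have hn : ‖z / 2‖ = ‖z‖ / 2 := by simp
    have hd : DifferentiableOn ℂ (fun ζ => h (z + z / 2 * ζ)) (ball 0 1) := by
      refine hh.comp (by fun_prop) fun ζ hζ => ?_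
      rw [mem_ball_zero_iff] at hζ
      have h1 : ‖z / 2 * ζ‖ ≤ ‖z‖ / 2 := by
        rw [norm_mul, hn]; nlinarith
      refine ⟨?_, ?_⟩
      · rw [mem_ball_zero_iff]
        linarith [norm_add_le z (z / 2 * ζ)]
      · rw [mem_singleton_iff]
        intro h0
        rw [add_eq_zero_iff_eq_neg] at h0
        have : ‖z‖ = ‖z / 2 * ζ‖ := by conv_lhs => rw [h0, norm_neg]
        linarith
    have h1 := pi_mul_sq_enorm_zero_le hd
    have h2 := setLIntegral_ball_comp_mul hz' z (fun ζ => ‖h ζ‖ₑ ^ 2)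
    rw [Measure.restrict_restrict measurableSet_ball]
    calc ENNReal.ofReal (Real.pi / 4) * ‖z * h z‖ₑ ^ 2
        = ENNReal.ofReal (‖z / 2‖ ^ 2) * (ENNReal.ofReal Real.pi * ‖h (z + z / 2 * 0)‖ₑ ^ 2) := by
          rw [mul_zero, add_zero, enorm_mul, mul_pow, ← ofReal_norm z,
            ← ENNReal.ofReal_pow (by positivity), ← mul_assoc, ← mul_assoc,
            ← ENNReal.ofReal_mul (by positivity), ← ENNReal.ofReal_mul (by positivity), hn]
          congr 2; ring
      _ ≤ ∫⁻ ζ in ball z ‖z / 2‖, ‖h ζ‖ₑ ^ 2 := by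
          rw [h2]; gcongr
      _ ≤ _ := by
          refine lintegral_mono_set fun ζ hζ => ?_
          rw [mem_ball, dist_eq_norm, hn] at hζ
          have : ‖ζ‖ ≤ ‖ζ - z‖ + ‖z‖ := by simpa using norm_add_le (ζ - z) z
          rw [mem_inter_iff, mem_ball_zero_iff, mem_ball_zero_iff]
          constructor <;> linarith
  -- Absolute continuity of the integral: the discs shrink to a null set. This is what gives
  -- `o(1/z)` rather than only `O(1/z)`.
  have hlim : Tendsto (fun z : ℂ => ∫⁻ ζ in ball (0 : ℂ) (2 * ‖z‖), ‖h ζ‖ₑ ^ 2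
      ∂(volume.restrict (ball (0 : ℂ) 1))) (𝓝[≠] 0) (𝓝 0) := by
    refine tendsto_setLIntegral_zero hi ?_
    have hv : Tendsto (fun z : ℂ => volume (ball (0 : ℂ) (2 * ‖z‖))) (𝓝[≠] 0) (𝓝 0) := by
      simp only [Complex.volume_ball]
      have h1 : Tendsto (fun z : ℂ => ENNReal.ofReal (2 * ‖z‖) ^ 2 * (NNReal.pi : ℝ≥0∞)) (𝓝 0)
          (𝓝 (ENNReal.ofReal (2 * ‖(0 : ℂ)‖) ^ 2 * (NNReal.pi : ℝ≥0∞))) := by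
        refine ENNReal.Tendsto.mul_const ?_ (Or.inr (by simp))
        refine ENNReal.Tendsto.pow (ENNReal.tendsto_ofReal ?_)
        exact (Continuous.tendsto (by fun_prop) _)
      simpa using h1.mono_left nhdsWithin_le_nhds
    exact tendsto_of_tendsto_of_tendsto_of_le_of_le tendsto_const_nhds hv (fun _ => zero_le)
      (fun z => Measure.restrict_apply_le _ _)
  have hpi : ENNReal.ofReal (Real.pi / 4) ≠ 0 := by simp [Real.pi_pos]
  have hev : ∀ᶠ z : ℂ in 𝓝[≠] 0, z ≠ 0 ∧ ‖z‖ < 1 / 2 := by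
    refine (eventually_mem_nhdsWithin).and (eventually_nhdsWithin_of_eventually_nhds ?_)
    have : Tendsto (fun z : ℂ => ‖z‖) (𝓝 0) (𝓝 0) := by simpa using (continuous_norm (E := ℂ)).tendsto 0
    exact this.eventually_lt_const (by norm_num)
  have h1 : Tendsto (fun z : ℂ => ENNReal.ofReal (Real.pi / 4) * ‖z * h z‖ₑ ^ 2) (𝓝[≠] 0)
      (𝓝 0) :=
    tendsto_of_tendsto_of_tendsto_of_le_of_le' tendsto_const_nhds hlim
      (Eventually.of_forall fun _ => zero_le) (hev.mono fun z hz => hbound z hz.1 hz.2)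
  rw [Asymptotics.isLittleO_iff]
  intro c hc
  have h2 : ENNReal.ofReal (Real.pi / 4) * ENNReal.ofReal c ^ 2 ≠ 0 := by
    simp [Real.pi_pos, hc]
  filter_upwards [h1.eventually_lt_const (pos_iff_ne_zero.mpr h2), hev] with z hz hz0
  have h3 := lt_of_mul_lt_mul_left' hz
  have h4 : ‖z * h z‖ₑ < ENNReal.ofReal c := lt_of_pow_lt_pow_left' 2 h3
  rw [← ofReal_norm, ENNReal.ofReal_lt_ofReal_iff hc, norm_mul] at h4
  rw [norm_inv, ← div_eq_mul_inv, le_div_iff₀ (norm_pos_iff.mpr hz0.1), mul_comm]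
  exact h4.le

/-- The weighted Bergman kernel reproduces square-integrable holomorphic functions on the punctured
disc. -/
theorem integral_kernel_mul_of_punctured {h : ℂ → ℂ}
    (hh : DifferentiableOn ℂ h (ball 0 1 \ {0}))
    (hi : ∫⁻ ζ in ball (0 : ℂ) 1, ‖h ζ‖ₑ ^ 2 ≠ ∞) {z : ℂ} (hz : ‖z‖ < 1) (hz0 : z ≠ 0) :
    ∫ ζ in ball (0 : ℂ) 1, ((1 - z * (starRingEnd ℂ) ζ) ^ 2)⁻¹ * h ζ = Real.pi * h z := by
  -- The value `h 0` is arbitrary; being constant, it is itself `o(1/z)`.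
  have hO : (fun z => h z - h 0) =o[𝓝[≠] 0] fun z => (z - 0)⁻¹ := by
    simp only [sub_zero]
    refine (isLittleO_inv_of_sq_integrable hh hi).sub ?_
    rw [Asymptotics.isLittleO_const_left]
    right
    exact tendsto_norm_atTop_iff_cobounded.mpr tendsto_inv₀_nhdsNE_zero
  have hd := Complex.differentiableOn_update_limUnder_of_isLittleO (ball_mem_nhds (0 : ℂ) one_pos)
    hh hO
  set H := Function.update h 0 (limUnder (𝓝[≠] 0) h) with hH
  have hae : H =ᵐ[volume.restrict (ball (0 : ℂ) 1)] h := by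
    refine ae_restrict_of_ae ?_
    filter_upwards [compl_mem_ae_iff.mpr (measure_singleton (μ := volume) (0 : ℂ))] with ζ hζ
    exact Function.update_of_ne hζ _ _
  have hfin : IsFiniteMeasure (volume.restrict (ball (0 : ℂ) 1)) :=
    ⟨by rw [Measure.restrict_apply_univ]; exact measure_ball_lt_top⟩
  have hm : AEStronglyMeasurable H (volume.restrict (ball (0 : ℂ) 1)) :=
    hd.continuousOn.aestronglyMeasurable measurableSet_ball
  have hHi : IntegrableOn H (ball 0 1) := by
    refine MemLp.integrable (q := 2) (by norm_num) ⟨hm, ?_⟩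
    rw [eLpNorm_lt_top_iff_lintegral_rpow_enorm_lt_top (by norm_num) (by norm_num)]
    norm_num
    rw [lintegral_congr_ae (hae.mono fun ζ hζ => by rw [hζ])]
    exact lt_top_iff_ne_top.mpr hi
  have := integral_kernel_mul hd hHi hz hz0
  rw [hH, Function.update_of_ne hz0] at this
  rw [← this]
  refine integral_congr_ae (hae.mono fun ζ hζ => ?_)
  simp only
  rw [← hζ]

/-! ### Boundedness of the absolute Bergman operator of the disc on `L⁴` -/

/-- Lebesgue measure on the unit disc. -/
noncomputable def discMeasure : Measure ℂ := volume.restrict (ball (0 : ℂ) 1)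

/-- The Bergman kernel of the unit disc, up to the factor `1 / π`. -/
noncomputable def discKernel (z ζ : ℂ) : ℂ := ((1 - z * (starRingEnd ℂ) ζ) ^ 2)⁻¹

/-- The integral operator whose kernel is the modulus of the Bergman kernel. -/
noncomputable def absBergman (u : ℂ → ℝ≥0∞) (z : ℂ) : ℝ≥0∞ :=
  ∫⁻ ζ, ‖discKernel z ζ‖ₑ * u ζ ∂discMeasure

instance : IsFiniteMeasure discMeasure :=
  ⟨by rw [discMeasure, Measure.restrict_apply_univ]; exact measure_ball_lt_top⟩

theorem measurable_discKernel : Measurable fun p : ℂ × ℂ => discKernel p.1 p.2 := by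
  have := Complex.continuous_conj.measurable
  unfold discKernel
  fun_prop

theorem enorm_discKernel_comm (z ζ : ℂ) : ‖discKernel z ζ‖ₑ = ‖discKernel ζ z‖ₑ := by
  have h : discKernel ζ z = (starRingEnd ℂ) (discKernel z ζ) := by
    simp [discKernel, mul_comm]
  rw [h, ← ofReal_norm, ← ofReal_norm, RCLike.norm_conj]

/-- Up to the factor `1 - |z r|²`, the modulus of the kernel on this circle is the Poisson kernel at
`z r`, whose mean is `1`. -/
theorem integral_circle_norm_discKernel {z : ℂ} (hz : ‖z‖ < 1) {r : ℝ} (hr0 : 0 < r)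
    (hr1 : r < 1) :
    ∫ θ in (0 : ℝ)..2 * Real.pi, ‖discKernel z (circleMap 0 r θ)‖ =
      2 * Real.pi / (1 - (‖z‖ * r) ^ 2) := by
  have hzr : ‖z * r‖ = ‖z‖ * r := by simp [abs_of_pos hr0]
  have hlt : ‖z‖ * r < 1 := by nlinarith [norm_nonneg z]
  have hpos : 0 < 1 - (‖z‖ * r) ^ 2 := by nlinarith [norm_nonneg z, mul_nonneg (norm_nonneg z) hr0.le]
  have hP := DiffContOnCl.circleAverage_poissonKernel_smul' (E := ℂ) (f := fun _ => 1) (R := 1)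
    (c := 0) (w := z * r) diffContOnCl_const (by rwa [mem_ball_zero_iff, hzr])
  rw [Real.circleAverage_def, inv_smul_eq_iff₀ (by positivity)] at hP
  have hE : ∀ θ : ℝ, ((‖circleMap 0 1 θ - 0‖ ^ 2 - ‖z * r - 0‖ ^ 2) /
      ‖circleMap 0 1 θ - 0 - (z * r - 0)‖ ^ 2) • (1 : ℂ) =
      (((1 - (‖z‖ * r) ^ 2) * ‖discKernel z (circleMap 0 r θ)‖ : ℝ) : ℂ) := by
    intro θ
    have h1 : (starRingEnd ℂ) (circleMap 0 1 θ) * circleMap 0 1 θ = 1 := by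
      rw [Complex.conj_mul']; simp
    have h2 : circleMap 0 r θ = r * circleMap 0 1 θ := by simp [circleMap]
    have h3 : circleMap 0 1 θ - z * r =
        circleMap 0 1 θ * (1 - z * (starRingEnd ℂ) (circleMap 0 r θ)) := by
      rw [h2, map_mul, Complex.conj_ofReal, mul_sub]
      linear_combination (z * r) * h1
    rw [sub_zero, sub_zero, h3, hzr, norm_mul, discKernel, norm_inv, norm_pow]
    simp [div_eq_mul_inv]
  simp only [hE] at hP
  rw [intervalIntegral.integral_ofReal, intervalIntegral.integral_const_mul, Complex.real_smul,
    mul_one] at hP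
  rw [eq_div_iff hpos.ne', mul_comm]
  exact_mod_cast hP

/-- The denominator satisfies `1 - (|z| r)² ≥ 1 - |z| r`, which dominates both `1 - |z|` and `1 -
r`. Keeping the maximum is what makes the radial integral below converge with the right power. -/
theorem lintegral_circle_enorm_discKernel_le {z : ℂ} (hz : ‖z‖ < 1) {r : ℝ} (hr0 : 0 < r)
    (hr1 : r < 1) :
    ∫⁻ θ in Ioo (-Real.pi) Real.pi, ‖discKernel z (circleMap 0 r θ)‖ₑ ≤
      ENNReal.ofReal (2 * Real.pi / max (1 - ‖z‖) (1 - r)) := by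
  have hc : Continuous fun θ => ‖discKernel z (circleMap 0 r θ)‖ := by
    have h1 : ContinuousOn (discKernel z) (ball 0 1) := continuousOn_kernel hz
    exact (h1.comp_continuous (continuous_circleMap 0 r)
      (fun θ => by simpa [abs_of_pos hr0] using hr1)).norm
  have hp : Function.Periodic (fun θ => ‖discKernel z (circleMap 0 r θ)‖) (2 * Real.pi) :=
    fun θ => by simp only [periodic_circleMap 0 r θ]
  have h2 := hp.intervalIntegral_add_eq (-Real.pi) 0
  rw [show -Real.pi + 2 * Real.pi = Real.pi by ring, zero_add,
    integral_circle_norm_discKernel hz hr0 hr1,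
    intervalIntegral.integral_of_le (by linarith [Real.pi_pos]),
    integral_Ioc_eq_integral_Ioo] at h2
  have h3 := ofReal_integral_eq_lintegral_ofReal
    (μ := volume.restrict (Ioo (-Real.pi) Real.pi))
    (f := fun θ => ‖discKernel z (circleMap 0 r θ)‖)
    ((hc.integrableOn_Icc (a := -Real.pi) (b := Real.pi)).mono_set Ioo_subset_Icc_self)
    (Eventually.of_forall fun _ => norm_nonneg _)
  simp only [ofReal_norm] at h3
  rw [← h3, h2]
  have hz0 := norm_nonneg z
  have hpos : 0 < max (1 - ‖z‖) (1 - r) := lt_max_of_lt_right (by linarith)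
  gcongr
  have h4 : ‖z‖ * r ≤ ‖z‖ := by nlinarith
  have h5 : ‖z‖ * r ≤ r := by nlinarith
  have h6 : 0 ≤ ‖z‖ * r := by positivity
  refine max_le ?_ ?_ <;> nlinarith

/-- Split at `x = δ`: below it the integrand is `x^(-s)/δ`, integrable at `0` because `s < 1`; above
it the integrand is `x^(-s-1)`, integrable at infinity because `s > 0`. -/
theorem lintegral_rpow_div_max_le {s δ : ℝ} (hs0 : 0 < s) (hs1 : s < 1) (hδ : 0 < δ) :
    ∫⁻ x in Ioi (0 : ℝ), ENNReal.ofReal (x ^ (-s) / max δ x) ≤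
      ENNReal.ofReal ((1 / (1 - s) + 1 / s) * δ ^ (-s)) := by
  rw [← Ioc_union_Ioi_eq_Ioi hδ.le]
  refine (lintegral_union_le _ _ _).trans ?_
  have h1 : ∫⁻ x in Ioc 0 δ, ENNReal.ofReal (x ^ (-s) / max δ x) ≤
      ENNReal.ofReal (1 / (1 - s) * δ ^ (-s)) := by
    have hi : IntegrableOn (fun x : ℝ => x ^ (-s)) (Ioc 0 δ) :=
      (intervalIntegral.intervalIntegrable_rpow' (by linarith)).1
    calc ∫⁻ x in Ioc 0 δ, ENNReal.ofReal (x ^ (-s) / max δ x)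
        ≤ ∫⁻ x in Ioc 0 δ, ENNReal.ofReal (x ^ (-s) * δ⁻¹) := by
          refine setLIntegral_mono' measurableSet_Ioc fun x hx => ?_
          rw [div_eq_mul_inv]
          have := Real.rpow_nonneg hx.1.le (-s)
          gcongr
          exact le_max_left _ _
      _ = ENNReal.ofReal (∫ x in Ioc 0 δ, x ^ (-s) * δ⁻¹) := by
          rw [ofReal_integral_eq_lintegral_ofReal (hi.mul_const _)]
          filter_upwards [ae_restrict_mem measurableSet_Ioc] with x hx
          have := Real.rpow_nonneg hx.1.le (-s)
          simp only [Pi.zero_apply]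
          positivity
      _ ≤ _ := by
          apply ENNReal.ofReal_le_ofReal
          rw [integral_mul_const, ← intervalIntegral.integral_of_le hδ.le,
            integral_rpow (Or.inl (by linarith)), Real.zero_rpow (by linarith),
            Real.rpow_add hδ, Real.rpow_one, sub_zero]
          apply le_of_eq
          have : -s + 1 ≠ 0 := by linarith
          have h' : 1 - s ≠ 0 := by linarith
          field_simp
          ring
  have h2 : ∫⁻ x in Ioi δ, ENNReal.ofReal (x ^ (-s) / max δ x) ≤
      ENNReal.ofReal (1 / s * δ ^ (-s)) := by
    calc ∫⁻ x in Ioi δ, ENNReal.ofReal (x ^ (-s) / max δ x)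
        = ∫⁻ x in Ioi δ, ENNReal.ofReal (x ^ (-s - 1)) := by
          refine setLIntegral_congr_fun measurableSet_Ioi fun x hx => ?_
          have hx' : δ < x := hx
          have hx0 : 0 < x := hδ.trans hx'
          rw [max_eq_right hx'.le, Real.rpow_sub_one hx0.ne']
      _ = ENNReal.ofReal (∫ x in Ioi δ, x ^ (-s - 1)) := by
          rw [ofReal_integral_eq_lintegral_ofReal (integrableOn_Ioi_rpow_of_lt (by linarith) hδ)]
          filter_upwards [ae_restrict_mem measurableSet_Ioi] with x hx
          exact Real.rpow_nonneg (hδ.trans hx).le _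
      _ ≤ _ := by
          apply ENNReal.ofReal_le_ofReal
          rw [integral_Ioi_rpow_of_lt (by linarith) hδ, sub_add_cancel]
          apply le_of_eq
          field_simp
  have h1s : 0 < 1 - s := by linarith
  rw [add_mul, ENNReal.ofReal_add (by positivity) (by positivity)]
  exact add_le_add h1 h2

/-- The Forelli–Rudin estimate. -/
theorem exists_absBergman_rpow_le {s : ℝ} (hs0 : 0 < s) (hs1 : s < 1) :
    ∃ C : ℝ≥0, ∀ z : ℂ, ‖z‖ < 1 →
      absBergman (fun ζ => ENNReal.ofReal (1 - ‖ζ‖) ^ (-s)) z ≤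
        C * ENNReal.ofReal (1 - ‖z‖) ^ (-s) := by
  refine ⟨(2 * Real.pi * (1 / (1 - s) + 1 / s)).toNNReal, fun z hz => ?_⟩
  have hm : Measurable fun ζ : ℂ => ‖discKernel z ζ‖ₑ * ENNReal.ofReal (1 - ‖ζ‖) ^ (-s) := by
    have := measurable_discKernel
    fun_prop
  have h1s : 0 < 1 - s := by linarith
  have hδ : 0 < 1 - ‖z‖ := by linarith
  rw [absBergman, discMeasure, setLIntegral_unitDisc_polar hm]
  calc ∫⁻ r in Ioo (0 : ℝ) 1, ENNReal.ofReal r * ∫⁻ θ in Ioo (-Real.pi) Real.pi,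
        ‖discKernel z (circleMap 0 r θ)‖ₑ * ENNReal.ofReal (1 - ‖circleMap 0 r θ‖) ^ (-s)
      -- The Jacobian `r` is bounded by `1`. The indicator extends the integrand to the whole line,
      -- where reflection `x = 1 - r` preserves the integral.
      ≤ ∫⁻ r in Ioo (0 : ℝ) 1, ENNReal.ofReal (2 * Real.pi) *
          (Ioi (0 : ℝ)).indicator
            (fun x => ENNReal.ofReal (x ^ (-s) / max (1 - ‖z‖) x)) (1 - r) := by
        refine setLIntegral_mono' measurableSet_Ioo fun r hr => ?_
        have hr' : 0 < 1 - r := by linarith [hr.2]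
        have hmx : 0 < max (1 - ‖z‖) (1 - r) := lt_max_of_lt_right hr'
        have hrs := Real.rpow_nonneg hr'.le (-s)
        have hmk : Measurable fun θ : ℝ => ‖discKernel z (circleMap 0 r θ)‖ₑ := by
          have := measurable_discKernel
          have := measurable_circleMap 0 r
          fun_prop
        simp only [norm_circleMap_zero, abs_of_pos hr.1]
        rw [lintegral_mul_const _ hmk, indicator_of_mem (by simpa using hr.2)]
        calc ENNReal.ofReal r * ((∫⁻ θ in Ioo (-Real.pi) Real.pi,
              ‖discKernel z (circleMap 0 r θ)‖ₑ) * ENNReal.ofReal (1 - r) ^ (-s))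
            ≤ 1 * (ENNReal.ofReal (2 * Real.pi / max (1 - ‖z‖) (1 - r)) *
                ENNReal.ofReal (1 - r) ^ (-s)) := by
              gcongr
              · exact ENNReal.ofReal_le_one.mpr hr.2.le
              · exact lintegral_circle_enorm_discKernel_le hz hr.1 hr.2
          _ = _ := by
              rw [one_mul, ENNReal.ofReal_rpow_of_pos hr', ← ENNReal.ofReal_mul (by positivity),
                ← ENNReal.ofReal_mul (by positivity)]
              congr 1
              ring
    _ ≤ ENNReal.ofReal (2 * Real.pi) * ∫⁻ r, (Ioi (0 : ℝ)).indicator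
            (fun x => ENNReal.ofReal (x ^ (-s) / max (1 - ‖z‖) x)) (1 - r) := by
        rw [← lintegral_const_mul' _ _ ENNReal.ofReal_ne_top]
        exact setLIntegral_le_lintegral _ _
    _ ≤ ENNReal.ofReal (2 * Real.pi) *
          ENNReal.ofReal ((1 / (1 - s) + 1 / s) * (1 - ‖z‖) ^ (-s)) := by
        rw [lintegral_sub_left_eq_self (fun r => (Ioi (0 : ℝ)).indicator
            (fun x => ENNReal.ofReal (x ^ (-s) / max (1 - ‖z‖) x)) r) 1,
          lintegral_indicator measurableSet_Ioi]
        gcongr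
        exact lintegral_rpow_div_max_le hs0 hs1 hδ
    _ = _ := by
        rw [ENNReal.ofReal_rpow_of_pos hδ, ← ENNReal.ofReal_mul (by positivity), ← mul_assoc,
          ENNReal.ofReal_mul (by positivity)]
        rfl

/-- The absolute Bergman operator of the disc is bounded on `L⁴`. -/
theorem exists_lintegral_absBergman_pow_four_le :
    ∃ C : ℝ≥0, ∀ u : ℂ → ℝ≥0∞, Measurable u →
      ∫⁻ z, absBergman u z ^ 4 ∂discMeasure ≤ C * ∫⁻ z, u z ^ 4 ∂discMeasure := by
  -- Schur's test with weight `φ^(1/8)`, `φ = 1 - |ζ|`, and Hölder exponents `4` and `4/3`. The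
  -- factor `φ^(-1/8)` becomes `φ^(-1/6)` after the power `4/3`; the cube of its Forelli–Rudin bound
  -- is `φ^(-1/2)`, which calls for the second exponent `1/2`.
  obtain ⟨C₁, hC₁⟩ := exists_absBergman_rpow_le (s := 1 / 6) (by norm_num) (by norm_num)
  obtain ⟨C₂, hC₂⟩ := exists_absBergman_rpow_le (s := 1 / 2) (by norm_num) (by norm_num)
  refine ⟨C₁ ^ 3 * C₂, fun u hu => ?_⟩
  set φ : ℂ → ℝ≥0∞ := fun ζ => ENNReal.ofReal (1 - ‖ζ‖) with hφ
  have hφm : Measurable φ := by fun_prop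
  have hK := measurable_discKernel
  have hφ0 : ∀ ζ ∈ ball (0 : ℂ) 1, φ ζ ≠ 0 := fun ζ hζ => by simpa [φ] using hζ
  have hφt : ∀ ζ, φ ζ ≠ ∞ := fun ζ => ENNReal.ofReal_ne_top
  have hmem : ∀ᵐ ζ ∂discMeasure, ζ ∈ ball (0 : ℂ) 1 := ae_restrict_mem measurableSet_ball
  have hpt : ∀ z ∈ ball (0 : ℂ) 1, absBergman u z ^ 4 ≤
      C₁ ^ 3 * ∫⁻ ζ, φ z ^ (-(1 / 2) : ℝ) *
        (‖discKernel z ζ‖ₑ * φ ζ ^ (1 / 2 : ℝ) * u ζ ^ 4) ∂discMeasure := by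
    intro z hz
    have hz' : ‖z‖ < 1 := by simpa using hz
    have hH := lintegral_rpow_mul_le (μ := discMeasure) (p := 4) (q := 4 / 3)
      (Real.holderConjugate_iff.mpr ⟨by norm_num, by norm_num⟩)
      (f := fun ζ => ‖discKernel z ζ‖ₑ ^ (1 / 4 : ℝ) * φ ζ ^ (1 / 8 : ℝ) * u ζ)
      (g := fun ζ => ‖discKernel z ζ‖ₑ ^ (3 / 4 : ℝ) * φ ζ ^ (-(1 / 8) : ℝ))
      (by fun_prop) (by fun_prop)
    have e1 : ∫⁻ ζ, ‖discKernel z ζ‖ₑ ^ (1 / 4 : ℝ) * φ ζ ^ (1 / 8 : ℝ) * u ζ *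
        (‖discKernel z ζ‖ₑ ^ (3 / 4 : ℝ) * φ ζ ^ (-(1 / 8) : ℝ)) ∂discMeasure =
        absBergman u z := by
      refine lintegral_congr_ae (hmem.mono fun ζ hζ => ?_)
      have k1 : ‖discKernel z ζ‖ₑ ^ (1 / 4 : ℝ) * ‖discKernel z ζ‖ₑ ^ (3 / 4 : ℝ) =
          ‖discKernel z ζ‖ₑ := by
        rw [← ENNReal.rpow_add_of_nonneg _ _ (by norm_num) (by norm_num)]
        norm_num
      have k2 : φ ζ ^ (1 / 8 : ℝ) * φ ζ ^ (-(1 / 8) : ℝ) = 1 := by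
        rw [← ENNReal.rpow_add _ _ (hφ0 ζ hζ) (hφt ζ)]
        norm_num
      simp only
      calc _ = (‖discKernel z ζ‖ₑ ^ (1 / 4 : ℝ) * ‖discKernel z ζ‖ₑ ^ (3 / 4 : ℝ)) *
            (φ ζ ^ (1 / 8 : ℝ) * φ ζ ^ (-(1 / 8) : ℝ)) * u ζ := by ring
        _ = _ := by rw [k1, k2, mul_one]
    have e2 : ∫⁻ ζ, (‖discKernel z ζ‖ₑ ^ (1 / 4 : ℝ) * φ ζ ^ (1 / 8 : ℝ) * u ζ) ^ (4 : ℝ)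
        ∂discMeasure = ∫⁻ ζ, ‖discKernel z ζ‖ₑ * φ ζ ^ (1 / 2 : ℝ) * u ζ ^ 4 ∂discMeasure := by
      refine lintegral_congr fun ζ => ?_
      rw [ENNReal.mul_rpow_of_nonneg _ _ (by norm_num),
        ENNReal.mul_rpow_of_nonneg _ _ (by norm_num), ← ENNReal.rpow_mul, ← ENNReal.rpow_mul]
      norm_num
    have e3 : ∫⁻ ζ, (‖discKernel z ζ‖ₑ ^ (3 / 4 : ℝ) * φ ζ ^ (-(1 / 8) : ℝ)) ^ (4 / 3 : ℝ)
        ∂discMeasure = absBergman (fun ζ => φ ζ ^ (-(1 / 6) : ℝ)) z := by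
      refine lintegral_congr fun ζ => ?_
      rw [ENNReal.mul_rpow_of_nonneg _ _ (by norm_num), ← ENNReal.rpow_mul, ← ENNReal.rpow_mul]
      norm_num
    rw [e1, e2, e3] at hH
    have e4 : (absBergman (fun ζ => φ ζ ^ (-(1 / 6) : ℝ)) z) ^ (4 - 1 : ℝ) ≤
        C₁ ^ 3 * φ z ^ (-(1 / 2) : ℝ) := by
      calc _ ≤ (C₁ * φ z ^ (-(1 / 6) : ℝ)) ^ (4 - 1 : ℝ) := by
            exact ENNReal.rpow_le_rpow (hC₁ z hz') (by norm_num)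
        _ = _ := by
            rw [ENNReal.mul_rpow_of_nonneg _ _ (by norm_num), ← ENNReal.rpow_mul]
            norm_num
    calc absBergman u z ^ 4 = absBergman u z ^ (4 : ℝ) := by norm_num
      _ ≤ (∫⁻ ζ, ‖discKernel z ζ‖ₑ * φ ζ ^ (1 / 2 : ℝ) * u ζ ^ 4 ∂discMeasure) *
          (C₁ ^ 3 * φ z ^ (-(1 / 2) : ℝ)) := hH.trans (by gcongr)
      _ = _ := by
        rw [lintegral_const_mul _ (by fun_prop)]
        ring
  -- Tonelli and the symmetry of `|K|` put `B` on `φ^(-1/2)`; its bound cancels the remaining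
  -- `φ^(1/2)`.
  calc ∫⁻ z, absBergman u z ^ 4 ∂discMeasure
      ≤ ∫⁻ z, C₁ ^ 3 * ∫⁻ ζ, φ z ^ (-(1 / 2) : ℝ) *
        (‖discKernel z ζ‖ₑ * φ ζ ^ (1 / 2 : ℝ) * u ζ ^ 4) ∂discMeasure ∂discMeasure :=
        lintegral_mono_ae (hmem.mono hpt)
    _ = C₁ ^ 3 * ∫⁻ ζ, (φ ζ ^ (1 / 2 : ℝ) * u ζ ^ 4) *
          absBergman (fun z => φ z ^ (-(1 / 2) : ℝ)) ζ ∂discMeasure := by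
        rw [lintegral_const_mul' _ _ (by simp), lintegral_lintegral_swap (by fun_prop)]
        congr 1
        refine lintegral_congr fun ζ => ?_
        rw [absBergman, ← lintegral_const_mul _ (by fun_prop)]
        refine lintegral_congr fun z => ?_
        rw [enorm_discKernel_comm ζ z]
        ring
    _ ≤ C₁ ^ 3 * ∫⁻ ζ, C₂ * u ζ ^ 4 ∂discMeasure := by
        refine mul_le_mul_right ?_ _
        refine lintegral_mono_ae (hmem.mono fun ζ hζ => ?_)
        calc φ ζ ^ (1 / 2 : ℝ) * u ζ ^ 4 * absBergman (fun z => φ z ^ (-(1 / 2) : ℝ)) ζ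
            ≤ φ ζ ^ (1 / 2 : ℝ) * u ζ ^ 4 * (C₂ * φ ζ ^ (-(1 / 2) : ℝ)) := by
              gcongr
              exact hC₂ ζ (by simpa using hζ)
          _ = (φ ζ ^ (1 / 2 : ℝ) * φ ζ ^ (-(1 / 2) : ℝ)) * (C₂ * u ζ ^ 4) := by ring
          _ = _ := by
              rw [← ENNReal.rpow_add _ _ (hφ0 ζ hζ) (hφt ζ)]
              norm_num
    _ = _ := by
        rw [lintegral_const_mul' _ _ (by simp)]
        push_cast
        ring

/-! ### A weak-type estimate on the disc with weight `|z|²` -/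

/-- The measure `|z|² dA` on the unit disc. -/
noncomputable def weightedDiscMeasure : Measure ℂ :=
  discMeasure.withDensity fun z => ((‖z‖₊ ^ 2 : ℝ≥0) : ℝ≥0∞)

instance : SFinite weightedDiscMeasure := by
  unfold weightedDiscMeasure
  infer_instance

theorem weightedDiscMeasure_le : weightedDiscMeasure ≤ discMeasure := by
  have h : (fun z : ℂ => ((‖z‖₊ ^ 2 : ℝ≥0) : ℝ≥0∞)) ≤ᵐ[discMeasure] 1 := by
    filter_upwards [ae_restrict_mem measurableSet_ball] with z hz
    have hz' : ‖z‖₊ ≤ 1 := (mem_ball_zero_iff.mp hz).le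
    exact ENNReal.coe_le_one_iff.mpr (pow_le_one₀ zero_le hz')
  exact (withDensity_mono h).trans_eq withDensity_one

theorem lintegral_weightedDiscMeasure {g : ℂ → ℝ≥0∞} (hg : Measurable g) :
    ∫⁻ z, g z ∂weightedDiscMeasure = ∫⁻ z, ‖z‖ₑ ^ 2 * g z ∂discMeasure := by
  rw [weightedDiscMeasure, lintegral_withDensity_eq_lintegral_mul _ (by fun_prop) hg]
  rfl

theorem measurable_absBergman_uncurry {α : Type*} [MeasurableSpace α] {g : α × ℂ → ℝ≥0∞}
    (hg : Measurable g) :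
    Measurable fun p : α × ℂ => absBergman (fun ζ => g (p.1, ζ)) p.2 := by
  have hK := measurable_discKernel
  have h : Measurable fun q : (α × ℂ) × ℂ => ‖discKernel q.1.2 q.2‖ₑ * g (q.1.1, q.2) := by
    fun_prop
  exact h.lintegral_prod_right'

theorem measurable_absBergman {u : ℂ → ℝ≥0∞} (hu : Measurable u) : Measurable (absBergman u) := by
  have hK := measurable_discKernel
  have h : Measurable fun q : ℂ × ℂ => ‖discKernel q.1 q.2‖ₑ * u q.2 := by fun_prop
  exact h.lintegral_prod_right'

/-- The weight is at most `R²` on a disc of area `π R²`. The fourth power expresses that `1/|z|`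
belongs to weak `L⁴` of this measure. -/
theorem weightedDiscMeasure_enorm_lt_le (R : ℝ≥0∞) :
    weightedDiscMeasure {z | ‖z‖ₑ < R} ≤ ENNReal.ofReal Real.pi * R ^ 4 := by
  rcases eq_or_ne R ∞ with rfl | hR
  · rw [ENNReal.top_pow (by norm_num), ENNReal.mul_top (by simp [Real.pi_pos])]
    exact le_top
  have hms : MeasurableSet {z : ℂ | ‖z‖ₑ < R} := measurableSet_lt (by fun_prop) (by fun_prop)
  have hball : {z : ℂ | ‖z‖ₑ < R} = ball 0 R.toReal := by
    ext z
    rw [mem_ofPred_eq, mem_ball_zero_iff, ← ofReal_norm, ENNReal.ofReal_lt_iff_lt_toReal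
      (norm_nonneg _) hR]
  calc weightedDiscMeasure {z | ‖z‖ₑ < R}
      = ∫⁻ z in {z : ℂ | ‖z‖ₑ < R}, ((‖z‖₊ ^ 2 : ℝ≥0) : ℝ≥0∞) ∂discMeasure := by
        rw [weightedDiscMeasure, withDensity_apply _ hms]
    _ ≤ ∫⁻ z in {z : ℂ | ‖z‖ₑ < R}, R ^ 2 ∂discMeasure := by
        refine setLIntegral_mono' hms fun z hz => ?_
        rw [ENNReal.coe_pow]
        exact pow_le_pow_left' (le_of_lt hz) 2
    _ = R ^ 2 * discMeasure {z : ℂ | ‖z‖ₑ < R} := setLIntegral_const _ _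
    _ ≤ R ^ 2 * volume (ball (0 : ℂ) R.toReal) := by
        rw [hball]
        exact mul_le_mul_right (Measure.restrict_apply_le _ _) _
    _ = _ := by
        rw [Complex.volume_ball, ENNReal.ofReal_toReal hR, ← NNReal.coe_real_pi,
          ENNReal.ofReal_coe_nnreal]
        ring

/-- The operator `u ↦ |z|⁻¹ B(|ζ| u)`, with `B` the absolute Bergman operator, is of weak type
`(4, 4)` for the measure `|z|² dA`. -/
theorem exists_weightedDiscMeasure_lt_absBergman_le :
    ∃ C : ℝ≥0, ∀ u : ℂ → ℝ≥0∞, Measurable u → ∀ t : ℝ≥0∞, t ≠ 0 → t ≠ ∞ →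
      weightedDiscMeasure {z | t * ‖z‖ₑ < absBergman (fun ζ => ‖ζ‖ₑ * u ζ) z} ≤
        C * (∫⁻ z, ‖z‖ₑ ^ 2 * u z ^ 4 ∂discMeasure) / t ^ 4 := by
  obtain ⟨C, hC⟩ := exists_lintegral_absBergman_pow_four_le
  obtain ⟨V, hV⟩ := WithTop.ne_top_iff_exists.mp (measure_ne_top discMeasure univ)
  change (V : ℝ≥0∞) = _ at hV
  refine ⟨Real.pi.toNNReal * 4 ^ 4 * V ^ 3 + 2 ^ 4 * C, fun u hu t ht0 ht => ?_⟩
  set I := ∫⁻ z, ‖z‖ₑ ^ 2 * u z ^ 4 ∂discMeasure with hI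
  set M := ∫⁻ z, ‖z‖ₑ * u z ∂discMeasure with hM
  set B := absBergman (fun ζ => ‖ζ‖ₑ * u ζ) with hB
  have hum : Measurable fun ζ => ‖ζ‖ₑ * u ζ := by fun_prop
  -- Since `|z| ≤ 1`, the power `|z|⁴` is at most the weight `|z|²`.
  have hpow : ∫⁻ z, (‖z‖ₑ * u z) ^ 4 ∂discMeasure ≤ I := by
    refine lintegral_mono_ae ?_
    filter_upwards [ae_restrict_mem measurableSet_ball] with z hz
    have hz' : ‖z‖₊ ≤ 1 := (mem_ball_zero_iff.mp hz).le
    have hz1 : ‖z‖ₑ ≤ 1 := ENNReal.coe_le_one_iff.mpr hz'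
    rw [mul_pow]
    exact mul_le_mul_left (pow_le_pow_of_le_one zero_le hz1 (by norm_num)) _
  have hM4 : M ^ 4 ≤ V ^ 3 * I := by
    have h := lintegral_rpow_le (μ := discMeasure) (p := 4) (by norm_num) hum.aemeasurable
    rw [← hV] at h
    norm_num at h
    refine h.trans ?_
    rw [mul_comm]
    gcongr
  -- For `|z| ≤ 1/2` one has `|1 - z conj ζ| ≥ 1/2`, so the kernel is at most `4` and `B ≤ 4 M`. For
  -- `|z| > 1/2` the condition forces `B > t/2`, which Chebyshev's inequality controls.
  have hsub : {z | t * ‖z‖ₑ < B z} ⊆ {z | ‖z‖ₑ < 4 * M / t} ∪ {z | (t / 2) ^ 4 ≤ B z ^ 4} := by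
    intro z hz
    have hz : t * ‖z‖ₑ < B z := hz
    by_cases hz2 : ‖z‖ ≤ 1 / 2
    · left
      have hle : B z ≤ 4 * M := by
        rw [hB, hM, ← lintegral_const_mul' _ _ (by norm_num)]
        refine lintegral_mono_ae ?_
        filter_upwards [ae_restrict_mem measurableSet_ball] with ζ hζ
        have hζ' : ‖ζ‖ ≤ 1 := (mem_ball_zero_iff.mp hζ).le
        refine mul_le_mul_left ?_ _
        have h1 := le_norm_one_sub_mul_conj z hζ'
        rw [← ofReal_norm, discKernel, norm_inv, norm_pow,
          show (4 : ℝ≥0∞) = ENNReal.ofReal 4 by norm_num]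
        refine ENNReal.ofReal_le_ofReal (inv_le_of_inv_le₀ (by norm_num) ?_)
        nlinarith
      rw [mem_ofPred_eq, ENNReal.lt_div_iff_mul_lt (Or.inl ht0) (Or.inl ht), mul_comm]
      exact hz.trans_le hle
    · right
      refine pow_le_pow_left' (le_trans ?_ hz.le) 4
      rw [div_eq_mul_inv]
      refine mul_le_mul_right ?_ _
      rw [← ofReal_norm, show (2 : ℝ≥0∞)⁻¹ = ENNReal.ofReal (1 / 2) by
        rw [one_div, ENNReal.ofReal_inv_of_pos (by norm_num)]; norm_num]
      exact ENNReal.ofReal_le_ofReal (not_le.mp hz2).le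
  have h1 : weightedDiscMeasure {z | ‖z‖ₑ < 4 * M / t} ≤
      (Real.pi.toNNReal * 4 ^ 4 * V ^ 3 : ℝ≥0) * I / t ^ 4 := by
    refine (weightedDiscMeasure_enorm_lt_le _).trans ?_
    calc ENNReal.ofReal Real.pi * (4 * M / t) ^ 4
        = ENNReal.ofReal Real.pi * 4 ^ 4 * M ^ 4 / t ^ 4 := by
          rw [div_eq_mul_inv, div_eq_mul_inv, mul_pow, mul_pow, ENNReal.inv_pow]; ring
      _ ≤ ENNReal.ofReal Real.pi * 4 ^ 4 * (V ^ 3 * I) / t ^ 4 := by gcongr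
      _ = _ := by
          push_cast
          rw [ENNReal.ofReal]
          ring_nf
  have h2 : weightedDiscMeasure {z | (t / 2) ^ 4 ≤ B z ^ 4} ≤ (2 ^ 4 * C : ℝ≥0) * I / t ^ 4 := by
    refine (weightedDiscMeasure_le _).trans ?_
    have ht2 : (t / 2) ^ 4 ≠ 0 := pow_ne_zero _ (ENNReal.div_ne_zero.mpr ⟨ht0, by norm_num⟩)
    have ht2' : (t / 2) ^ 4 ≠ ∞ := ENNReal.pow_ne_top (ENNReal.div_ne_top ht (by norm_num))
    refine (meas_ge_le_lintegral_div ((measurable_absBergman hum).pow_const 4).aemeasurable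
      ht2 ht2').trans ?_
    calc (∫⁻ z, B z ^ 4 ∂discMeasure) / (t / 2) ^ 4 ≤ (C * I) / (t / 2) ^ 4 := by
          gcongr
          exact (hC _ hum).trans (by gcongr)
      _ = _ := by
          rw [div_eq_mul_inv t 2, mul_pow, div_eq_mul_inv, div_eq_mul_inv,
            ENNReal.mul_inv (Or.inr (by simp)) (Or.inr (by simp)), ENNReal.inv_pow (a := 2⁻¹),
            inv_inv]
          push_cast
          ring
  refine (measure_mono hsub).trans ((measure_union_le _ _).trans ((add_le_add h1 h2).trans_eq ?_))
  rw [← ENNReal.add_div, ← add_mul, ← ENNReal.coe_add]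

/-! ### Coordinates on the Hartogs triangle -/

/-- The biholomorphism `(w, z) ↦ (w z, z)` from `𝔻 × 𝔻*` onto the Hartogs triangle. -/
def hartogsChart (p : ℂ × ℂ) : ℂ × ℂ := (p.1 * p.2, p.2)

theorem measurable_hartogsChart : Measurable hartogsChart := by
  unfold hartogsChart
  fun_prop

/-- For fixed `z ≠ 0`, `w ↦ w z` maps the unit disc onto the disc of radius `|z|` with Jacobian
`|z|²`, which is the weight. At `z = 0` the slice is empty and the weight vanishes. -/
theorem measurePreserving_hartogsChart :
    MeasurePreserving hartogsChart (discMeasure.prod weightedDiscMeasure)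
      (volume.restrict (hartogsTriangle : Set (ℂ × ℂ))) := by
  refine ⟨measurable_hartogsChart, Measure.ext_of_lintegral _ fun f hf => ?_⟩
  have hfc : Measurable fun p => f (hartogsChart p) := hf.comp measurable_hartogsChart
  have hms : MeasurableSet (hartogsTriangle : Set (ℂ × ℂ)) :=
    hartogsTriangle.isOpen.measurableSet
  rw [lintegral_map hf measurable_hartogsChart, lintegral_prod_symm' _ hfc,
    lintegral_weightedDiscMeasure hfc.lintegral_prod_left', ← lintegral_indicator hms,
    Measure.volume_eq_prod, lintegral_prod_symm' _ (hf.indicator hms), discMeasure,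
    ← lintegral_indicator measurableSet_ball]
  refine lintegral_congr fun z => ?_
  by_cases hz : z ∈ ball (0 : ℂ) 1
  · have hz' : ‖z‖ < 1 := by simpa using hz
    rw [indicator_of_mem hz]
    have h1 : ∀ x, (hartogsTriangle : Set (ℂ × ℂ)).indicator f (x, z) =
        (ball (0 : ℂ) ‖z‖).indicator (fun x => f (x, z)) x := by
      intro x
      have hiff : (x, z) ∈ (hartogsTriangle : Set (ℂ × ℂ)) ↔ x ∈ ball (0 : ℂ) ‖z‖ := by
        rw [mem_ball_zero_iff]
        exact ⟨fun h => h.1, fun h => ⟨h, hz'⟩⟩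
      by_cases hx : x ∈ ball (0 : ℂ) ‖z‖
      · rw [indicator_of_mem hx, indicator_of_mem (hiff.mpr hx)]
      · rw [indicator_of_notMem hx, indicator_of_notMem (mt hiff.mp hx)]
    simp only [h1]
    rw [lintegral_indicator measurableSet_ball]
    rcases eq_or_ne z 0 with rfl | hz0
    · simp
    · rw [setLIntegral_ball_comp_mul hz0, ENNReal.ofReal_pow (norm_nonneg _), ofReal_norm]
      simp only [hartogsChart, zero_add, mul_comm z]
  · rw [indicator_of_notMem hz]
    symm
    rw [lintegral_eq_zero_iff' (by fun_prop)]
    refine Eventually.of_forall fun x => indicator_of_notMem ?_ _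
    intro h
    exact hz (by simpa using h.2)

/-! ### The reproducing kernel of the Hartogs triangle -/

theorem hartogsChart_mem {p : ℂ × ℂ} (h1 : ‖p.1‖ < 1) (h2 : ‖p.2‖ < 1) (h0 : p.2 ≠ 0) :
    hartogsChart p ∈ (hartogsTriangle : Set (ℂ × ℂ)) := by
  refine ⟨?_, h2⟩
  simp only [hartogsChart, norm_mul]
  nlinarith [norm_pos_iff.mpr h0]

theorem discMeasure_eq_restrict_punctured :
    discMeasure = volume.restrict (ball (0 : ℂ) 1 \ {0}) := by
  refine Measure.restrict_congr_set (ae_eq_symm ?_)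
  exact sdiff_null_ae_eq_self (measure_singleton 0)

theorem ae_discMeasure : ∀ᵐ z ∂discMeasure, ‖z‖ < 1 ∧ z ≠ 0 := by
  rw [discMeasure_eq_restrict_punctured]
  filter_upwards [ae_restrict_mem (measurableSet_ball.diff (measurableSet_singleton 0))] with z hz
  exact ⟨by simpa using hz.1, hz.2⟩

theorem ae_weightedDiscMeasure : ∀ᵐ z ∂weightedDiscMeasure, ‖z‖ < 1 ∧ z ≠ 0 :=
  (withDensity_absolutelyContinuous _ _).ae_le ae_discMeasure

theorem prod_weightedDiscMeasure :
    discMeasure.prod weightedDiscMeasure =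
      (discMeasure.prod discMeasure).withDensity fun p => ((‖p.2‖₊ ^ 2 : ℝ≥0) : ℝ≥0∞) :=
  prod_withDensity_right (by fun_prop)

/-- The kernel of the Hartogs triangle in the coordinates `hartogsChart`, up to a factor depending
only on `p`. -/
noncomputable def hartogsKernel (p η : ℂ × ℂ) : ℂ :=
  discKernel (η.1 / η.2) p.1 * discKernel η.2 p.2 * η.2⁻¹

theorem norm_discKernel_le {z ζ : ℂ} (hz : ‖z‖ < 1) (hζ : ‖ζ‖ < 1) :
    ‖discKernel z ζ‖ ≤ ((1 - ‖z‖) ^ 2)⁻¹ := by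
  have h1 := le_norm_one_sub_mul_conj z hζ.le
  have h2 : 0 < 1 - ‖z‖ := by linarith
  rw [discKernel, norm_inv, norm_pow]
  gcongr

theorem conj_discKernel (z ζ : ℂ) : (starRingEnd ℂ) (discKernel z ζ) = discKernel ζ z := by
  simp [discKernel, mul_comm]

/-- Against the density `|z|² = z conj z`, the factor `1 / conj z` leaves a single `z`, which turns
`h` into `z h` paired with the bidisc kernel. -/
theorem conj_hartogsKernel_chart (p : ℂ × ℂ) {q : ℂ × ℂ} (hq : q.2 ≠ 0) :
    (starRingEnd ℂ) (hartogsKernel p (hartogsChart q)) =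
      discKernel p.1 q.1 * discKernel p.2 q.2 * ((starRingEnd ℂ) q.2)⁻¹ := by
  simp only [hartogsKernel, hartogsChart, map_mul, conj_discKernel, map_inv₀,
    mul_div_cancel_right₀ _ hq]

/-- Together with `memLp_hartogsKernel`, this places the kernel in `A²`, where the projection fixes
it. -/
theorem differentiableOn_hartogsKernel {p : ℂ × ℂ} (h1 : ‖p.1‖ < 1) (h2 : ‖p.2‖ < 1) :
    DifferentiableOn ℂ (hartogsKernel p) hartogsTriangle := by
  have hne : ∀ η ∈ (hartogsTriangle : Set (ℂ × ℂ)), η.2 ≠ 0 := by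
    rintro η ⟨h, -⟩ h0
    rw [h0, norm_zero] at h
    exact absurd h (not_lt.mpr (norm_nonneg _))
  have hlt : ∀ η ∈ (hartogsTriangle : Set (ℂ × ℂ)), ‖η.1 / η.2‖ < 1 := by
    rintro η hη
    rw [norm_div, div_lt_one (norm_pos_iff.mpr (hne η hη))]
    exact hη.1
  unfold hartogsKernel discKernel
  refine ((DifferentiableOn.inv ?_ ?_).mul (DifferentiableOn.inv ?_ ?_)).mul
    (DifferentiableOn.inv ?_ hne)
  · refine DifferentiableOn.pow (DifferentiableOn.sub (by fun_prop)
      (DifferentiableOn.mul ?_ (by fun_prop))) 2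
    simp only [div_eq_mul_inv]
    exact differentiableOn_fst.mul (differentiableOn_snd.inv hne)
  · exact fun η hη => pow_ne_zero 2 (one_sub_mul_conj_ne_zero (hlt η hη) h1)
  · fun_prop
  · exact fun η hη => pow_ne_zero 2 (one_sub_mul_conj_ne_zero hη.2 h2)
  · fun_prop

/-- In the chart the density `|z|²` cancels the pole of the squared kernel, leaving disc kernels
that are bounded for fixed `p`, on a finite measure. -/
theorem memLp_hartogsKernel {p : ℂ × ℂ} (h1 : ‖p.1‖ < 1) (h2 : ‖p.2‖ < 1) :
    MemLp (hartogsKernel p) 2 (volume.restrict (hartogsTriangle : Set (ℂ × ℂ))) := by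
  have hK := measurable_discKernel
  have hm : Measurable (hartogsKernel p) := by
    unfold hartogsKernel
    have : Measurable fun η : ℂ × ℂ => discKernel (η.1 / η.2) p.1 := by fun_prop
    fun_prop
  refine ⟨hm.aestronglyMeasurable, ?_⟩
  rw [eLpNorm_lt_top_iff_lintegral_rpow_enorm_lt_top (by norm_num) (by norm_num)]
  norm_num
  have hmc : Measurable fun q => ‖hartogsKernel p (hartogsChart q)‖ₑ ^ 2 :=
    (hm.comp measurable_hartogsChart).enorm.pow_const 2
  rw [← measurePreserving_hartogsChart.lintegral_comp (by fun_prop), prod_weightedDiscMeasure,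
    lintegral_withDensity_eq_lintegral_mul _ (by fun_prop)
      hmc]
  have hb : ∀ᵐ q ∂(discMeasure.prod discMeasure),
      ((fun q : ℂ × ℂ => ((‖q.2‖₊ ^ 2 : ℝ≥0) : ℝ≥0∞)) *
        fun q => ‖hartogsKernel p (hartogsChart q)‖ₑ ^ 2) q ≤
      ENNReal.ofReal (((1 - ‖p.1‖) ^ 2)⁻¹ * ((1 - ‖p.2‖) ^ 2)⁻¹) ^ 2 := by
    filter_upwards [Measure.quasiMeasurePreserving_fst.ae ae_discMeasure,
      Measure.quasiMeasurePreserving_snd.ae ae_discMeasure] with q hq1 hq2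
    have hk : ‖hartogsKernel p (hartogsChart q)‖ =
        ‖discKernel p.1 q.1‖ * ‖discKernel p.2 q.2‖ * ‖q.2‖⁻¹ := by
      rw [← RCLike.norm_conj, conj_hartogsKernel_chart p hq2.2, norm_mul, norm_mul, norm_inv,
        RCLike.norm_conj]
    have hpos : 0 < ‖q.2‖ := norm_pos_iff.mpr hq2.2
    rw [Pi.mul_apply, ENNReal.coe_pow, ← mul_pow]
    refine pow_le_pow_left' ?_ 2
    change ‖q.2‖ₑ * _ ≤ _
    rw [← enorm_mul, ← ofReal_norm, norm_mul, hk]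
    apply ENNReal.ofReal_le_ofReal
    calc ‖q.2‖ * (‖discKernel p.1 q.1‖ * ‖discKernel p.2 q.2‖ * ‖q.2‖⁻¹)
        = ‖discKernel p.1 q.1‖ * ‖discKernel p.2 q.2‖ := by field_simp
      _ ≤ _ := mul_le_mul (norm_discKernel_le h1 hq1.1) (norm_discKernel_le h2 hq2.1)
          (norm_nonneg _) (by positivity)
  refine (lintegral_mono_ae hb).trans_lt ?_
  rw [lintegral_const]
  exact ENNReal.mul_lt_top (ENNReal.pow_lt_top ENNReal.ofReal_lt_top) (measure_lt_top _ _)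

/-- The kernel of the Hartogs triangle reproduces square-integrable holomorphic functions. -/
theorem integral_conj_hartogsKernel_mul {h : ℂ × ℂ → ℂ}
    (hh : DifferentiableOn ℂ h hartogsTriangle)
    (hi : MemLp h 2 (volume.restrict (hartogsTriangle : Set (ℂ × ℂ)))) :
    ∀ᵐ p ∂(discMeasure.prod weightedDiscMeasure),
      ∫ η in (hartogsTriangle : Set (ℂ × ℂ)), (starRingEnd ℂ) (hartogsKernel p η) * h η =
        Real.pi ^ 2 * (p.2 * h (hartogsChart p)) := by
  set H : ℂ × ℂ → ℂ := fun q => q.2 * h (hartogsChart q) with hH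
  have hcomp : MemLp (fun q => h (hartogsChart q)) 2 (discMeasure.prod weightedDiscMeasure) :=
    hi.comp_measurePreserving measurePreserving_hartogsChart
  have hslice1 : ∀ w : ℂ, ‖w‖ < 1 → DifferentiableOn ℂ (fun z => H (w, z)) (ball 0 1 \ {0}) := by
    intro w hw
    refine differentiableOn_id.mul (hh.comp ?_ fun z hz => ?_)
    · unfold hartogsChart; fun_prop
    · exact hartogsChart_mem hw (by simpa using hz.1) hz.2
  have hslice2 : ∀ z : ℂ, ‖z‖ < 1 → z ≠ 0 → DifferentiableOn ℂ (fun w => H (w, z)) (ball 0 1) := by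
    intro z hz hz0
    refine (differentiableOn_const z).mul (hh.comp ?_ fun w hw => ?_)
    · unfold hartogsChart; fun_prop
    · exact hartogsChart_mem (by simpa using hw) hz hz0
  -- `hcomp` concerns the weighted measure; for the unweighted one, continuity off the null set `z =
  -- 0` is used.
  have hHm : AEStronglyMeasurable H (discMeasure.prod discMeasure) := by
    have hc : ContinuousOn H (ball 0 1 ×ˢ (ball 0 1 \ {0})) := by
      refine continuousOn_snd.mul (hh.continuousOn.comp ?_ fun q hq => ?_)
      · unfold hartogsChart; fun_prop
      · exact hartogsChart_mem (by simpa using hq.1) (by simpa using hq.2.1) hq.2.2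
    have := hc.aestronglyMeasurable (μ := volume.prod volume) (measurableSet_ball.prod
      (measurableSet_ball.diff (measurableSet_singleton 0)))
    rw [← Measure.prod_restrict, ← discMeasure_eq_restrict_punctured] at this
    exact this
  have hHL : MemLp H 2 (discMeasure.prod discMeasure) := by
    refine ⟨hHm, ?_⟩
    have h2 := hcomp.2
    rw [eLpNorm_lt_top_iff_lintegral_rpow_enorm_lt_top (by norm_num) (by norm_num)] at h2 ⊢
    rw [prod_weightedDiscMeasure, lintegral_withDensity_eq_lintegral_mul_non_measurable _
      (by fun_prop) (Eventually.of_forall fun _ => ENNReal.coe_lt_top)] at h2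
    refine (lintegral_congr fun q => ?_).trans_lt h2
    norm_num [hH, mul_pow]
    rfl
  have hHi : Integrable H (discMeasure.prod discMeasure) := hHL.integrable (by norm_num)
  have hsq : Integrable (fun q => ‖H q‖ ^ 2) (discMeasure.prod discMeasure) :=
    hHL.integrable_norm_pow (by norm_num)
  -- The slices in `z` are punctured, so they need square-integrability; those in `w` are
  -- holomorphic on the full disc, so integrability suffices in `hrep2`. In both, the exceptional
  -- set is independent of the evaluation point, as the iterated integral requires.
  have hrep1 : ∀ᵐ w ∂discMeasure, ∀ z, ‖z‖ < 1 → z ≠ 0 →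
      ∫ z', discKernel z z' * H (w, z') ∂discMeasure = Real.pi * H (w, z) := by
    filter_upwards [ae_discMeasure, hsq.prod_right_ae] with w hw hw2 z hz hz0
    refine integral_kernel_mul_of_punctured (h := fun z => H (w, z)) (hslice1 w hw.1) ?_ hz hz0
    have := hw2.2
    rw [HasFiniteIntegral] at this
    simp only [enorm_pow, enorm_norm] at this
    exact this.ne
  have hrep2 : ∀ᵐ z ∂discMeasure, ∀ w, ‖w‖ < 1 → w ≠ 0 →
      ∫ w', discKernel w w' * H (w', z) ∂discMeasure = Real.pi * H (w, z) := by
    filter_upwards [ae_discMeasure, hHi.prod_left_ae] with z hz hz2 w hw hw0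
    exact integral_kernel_mul (h := fun w => H (w, z)) (hslice2 z hz.1 hz.2) hz2 hw hw0
  filter_upwards [Measure.quasiMeasurePreserving_fst.ae ae_discMeasure,
    Measure.quasiMeasurePreserving_snd.ae ae_weightedDiscMeasure,
    Measure.quasiMeasurePreserving_snd.ae
      ((withDensity_absolutelyContinuous _ _).ae_le hrep2)] with p hp1 hp2 hp3
  have hKm := measurable_discKernel
  have hint : Integrable (fun q : ℂ × ℂ => discKernel p.1 q.1 * discKernel p.2 q.2 * H q)
      (discMeasure.prod discMeasure) := by
    refine hHi.bdd_mul (c := ((1 - ‖p.1‖) ^ 2)⁻¹ * ((1 - ‖p.2‖) ^ 2)⁻¹)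
      (Measurable.aestronglyMeasurable (by fun_prop)) ?_
    filter_upwards [Measure.quasiMeasurePreserving_fst.ae ae_discMeasure,
      Measure.quasiMeasurePreserving_snd.ae ae_discMeasure] with q hq1 hq2
    rw [norm_mul]
    exact mul_le_mul (norm_discKernel_le hp1.1 hq1.1) (norm_discKernel_le hp2.1 hq2.1)
          (norm_nonneg _) (by positivity)
  have hmeas : AEStronglyMeasurable (fun η => (starRingEnd ℂ) (hartogsKernel p η) * h η)
      (Measure.map hartogsChart (discMeasure.prod weightedDiscMeasure)) := by
    rw [measurePreserving_hartogsChart.map_eq]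
    exact (Complex.continuous_conj.comp_aestronglyMeasurable
      (memLp_hartogsKernel hp1.1 hp2.1).1).mul hi.1
  calc ∫ η in (hartogsTriangle : Set (ℂ × ℂ)), (starRingEnd ℂ) (hartogsKernel p η) * h η
      = ∫ q, (starRingEnd ℂ) (hartogsKernel p (hartogsChart q)) * h (hartogsChart q)
          ∂(discMeasure.prod weightedDiscMeasure) := by
        rw [← measurePreserving_hartogsChart.map_eq,
          integral_map measurable_hartogsChart.aemeasurable hmeas]
    _ = ∫ q, discKernel p.1 q.1 * discKernel p.2 q.2 * H q ∂(discMeasure.prod discMeasure) := by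
        rw [prod_weightedDiscMeasure, integral_withDensity_eq_integral_smul (by fun_prop)]
        refine integral_congr_ae ?_
        filter_upwards [Measure.quasiMeasurePreserving_snd.ae ae_discMeasure] with q hq
        have hc0 : (starRingEnd ℂ) q.2 ≠ 0 := by simpa using hq.2
        have hn : ((‖q.2‖₊ ^ 2 : ℝ≥0) : ℂ) = (starRingEnd ℂ) q.2 * q.2 := by
          rw [Complex.conj_mul']; norm_cast
        rw [conj_hartogsKernel_chart p hq.2, NNReal.smul_def, Complex.real_smul]
        change ((‖q.2‖₊ ^ 2 : ℝ≥0) : ℂ) * _ = _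
        rw [hn, hH]
        field_simp
    _ = ∫ w', discKernel p.1 w' * (Real.pi * H (w', p.2)) ∂discMeasure := by
        rw [integral_prod _ hint]
        refine integral_congr_ae ?_
        filter_upwards [hrep1] with w' hw'
        simp only [mul_assoc]
        rw [integral_const_mul, hw' p.2 hp2.1 hp2.2]
    _ = Real.pi ^ 2 * (p.2 * h (hartogsChart p)) := by
        simp only [mul_left_comm _ (Real.pi : ℂ)]
        rw [integral_const_mul, hp3 p.1 hp1.1 hp1.2]
        simp only [hH]
        ring

/-- The Bergman projection of the Hartogs triangle is dominated by the integral operator whose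
kernel is the modulus of the Bergman kernel. -/
theorem enorm_bergmanProjection_hartogs_le
    (F : Lp ℂ 2 (volume.restrict (hartogsTriangle : Set (ℂ × ℂ)))) :
    ∀ᵐ p ∂(discMeasure.prod weightedDiscMeasure),
      ‖p.2‖ₑ * ‖bergmanProjection hartogsTriangle F (hartogsChart p)‖ₑ ≤
        absBergman (fun z => ‖z‖ₑ * absBergman (fun w => ‖F (hartogsChart (w, z))‖ₑ) p.1) p.2 := by
  obtain ⟨h, hh, hfh⟩ : bergmanProjection hartogsTriangle F ∈ bergmanSpace hartogsTriangle :=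
    Submodule.starProjection_apply_mem _ _
  have hhL : MemLp h 2 (volume.restrict (hartogsTriangle : Set (ℂ × ℂ))) :=
    (memLp_congr_ae hfh).mp (Lp.memLp _)
  filter_upwards [integral_conj_hartogsKernel_mul hh hhL,
    measurePreserving_hartogsChart.quasiMeasurePreserving.ae hfh,
    Measure.quasiMeasurePreserving_fst.ae ae_discMeasure,
    Measure.quasiMeasurePreserving_snd.ae ae_weightedDiscMeasure] with p hp hph hp1 hp2
  have hkL := memLp_hartogsKernel hp1.1 hp2.1
  have hkmem : hkL.toLp ∈ bergmanSpace hartogsTriangle :=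
    ⟨_, differentiableOn_hartogsKernel hp1.1 hp2.1, hkL.coeFn_toLp⟩
  -- The projection is self-adjoint and fixes the kernel. By the reproducing formula the left side
  -- is `π² z (P F)` at the chosen point, which expresses `P F` as an integral of `F`.
  have hinner : inner ℂ hkL.toLp (bergmanProjection hartogsTriangle F) =
      inner ℂ hkL.toLp F := by
    rw [bergmanProjection, ← Submodule.inner_starProjection_left_eq_right,
      Submodule.starProjection_eq_self_iff.mpr hkmem]
  have hform : ∀ (G : Lp ℂ 2 (volume.restrict (hartogsTriangle : Set (ℂ × ℂ)))) (g : ℂ × ℂ → ℂ),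
      G =ᵐ[volume.restrict (hartogsTriangle : Set (ℂ × ℂ))] g →
      inner ℂ hkL.toLp G =
        ∫ η in (hartogsTriangle : Set (ℂ × ℂ)), (starRingEnd ℂ) (hartogsKernel p η) * g η := by
    intro G g hG
    rw [L2.inner_def]
    refine integral_congr_ae ?_
    filter_upwards [hG, hkL.coeFn_toLp] with η h1 h2
    rw [h1, h2, RCLike.inner_apply']
  rw [hform _ _ hfh, hp, hform F F EventuallyEq.rfl] at hinner
  have hFm : Measurable fun η => F η := (Lp.stronglyMeasurable F).measurable
  have hFc : Measurable fun q => F (hartogsChart q) := hFm.comp measurable_hartogsChart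
  have hK := measurable_discKernel
  have hkm : Measurable (hartogsKernel p) := by
    unfold hartogsKernel
    have : Measurable fun η : ℂ × ℂ => discKernel (η.1 / η.2) p.1 := by fun_prop
    fun_prop
  -- Each disc kernel omits its factor `1/π`; for an upper bound it is enough that `π² ≥ 1`.
  have hpi : 1 ≤ ‖((Real.pi : ℂ) ^ 2)‖ₑ := by
    rw [← ofReal_norm, norm_pow, Complex.norm_real, Real.norm_of_nonneg Real.pi_pos.le,
      ENNReal.one_le_ofReal]
    nlinarith [Real.pi_gt_three]
  have hinnerm : Measurable fun z : ℂ => absBergman (fun w => ‖F (hartogsChart (w, z))‖ₑ) p.1 := by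
    have : Measurable fun q : ℂ × ℂ => ‖discKernel p.1 q.1‖ₑ * ‖F (hartogsChart q)‖ₑ := by fun_prop
    exact this.lintegral_prod_left'
  calc ‖p.2‖ₑ * ‖bergmanProjection hartogsTriangle F (hartogsChart p)‖ₑ
      ≤ ‖((Real.pi : ℂ) ^ 2)‖ₑ * (‖p.2‖ₑ * ‖h (hartogsChart p)‖ₑ) := by
        rw [hph]
        exact le_mul_of_one_le_left zero_le hpi
    _ = ‖∫ η in (hartogsTriangle : Set (ℂ × ℂ)), (starRingEnd ℂ) (hartogsKernel p η) * F η‖ₑ := by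
        rw [← hinner, enorm_mul, enorm_mul]
    _ ≤ ∫⁻ η in (hartogsTriangle : Set (ℂ × ℂ)), ‖hartogsKernel p η‖ₑ * ‖F η‖ₑ := by
        refine (enorm_integral_le_lintegral_enorm _).trans_eq (lintegral_congr fun η => ?_)
        rw [enorm_mul, ← ofReal_norm, RCLike.norm_conj, ofReal_norm]
    _ = ∫⁻ q, ‖hartogsKernel p (hartogsChart q)‖ₑ * ‖F (hartogsChart q)‖ₑ
          ∂(discMeasure.prod weightedDiscMeasure) :=
        (measurePreserving_hartogsChart.lintegral_comp (by fun_prop)).symm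
    _ = ∫⁻ q, ‖discKernel p.1 q.1‖ₑ * ‖discKernel p.2 q.2‖ₑ * ‖q.2‖ₑ * ‖F (hartogsChart q)‖ₑ
          ∂(discMeasure.prod discMeasure) := by
        have hkc : Measurable fun q => hartogsKernel p (hartogsChart q) :=
          hkm.comp measurable_hartogsChart
        rw [prod_weightedDiscMeasure, lintegral_withDensity_eq_lintegral_mul _ (by fun_prop)
          (by fun_prop)]
        refine lintegral_congr_ae ?_
        filter_upwards [Measure.quasiMeasurePreserving_snd.ae ae_discMeasure] with q hq
        have hk : ‖hartogsKernel p (hartogsChart q)‖ₑ =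
            ‖discKernel p.1 q.1‖ₑ * ‖discKernel p.2 q.2‖ₑ * ‖q.2‖ₑ⁻¹ := by
          rw [← ofReal_norm, ← RCLike.norm_conj, conj_hartogsKernel_chart p hq.2, ofReal_norm,
            enorm_mul, enorm_mul, enorm_inv (by simpa using hq.2), ← ofReal_norm ((starRingEnd ℂ) q.2),
            RCLike.norm_conj, ofReal_norm]
        have hq0 : ‖q.2‖ₑ ≠ 0 := by simpa using hq.2
        rw [Pi.mul_apply, hk, ENNReal.coe_pow]
        change ‖q.2‖ₑ ^ 2 * _ = _
        calc _ = ‖discKernel p.1 q.1‖ₑ * ‖discKernel p.2 q.2‖ₑ * ‖q.2‖ₑ * (‖q.2‖ₑ * ‖q.2‖ₑ⁻¹) *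
              ‖F (hartogsChart q)‖ₑ := by ring
          _ = _ := by rw [ENNReal.mul_inv_cancel hq0 enorm_ne_top, mul_one]
    _ = _ := by
        rw [lintegral_prod_symm' _ (by fun_prop)]
        refine lintegral_congr fun z => ?_
        have hs : Measurable fun w : ℂ => ‖discKernel p.1 w‖ₑ * ‖F (hartogsChart (w, z))‖ₑ := by
          have : Measurable fun w : ℂ => F (hartogsChart (w, z)) :=
            hFc.comp (measurable_id.prodMk measurable_const)
          fun_prop
        change _ = ‖discKernel p.2 z‖ₑ * (‖z‖ₑ *
          ∫⁻ w, ‖discKernel p.1 w‖ₑ * ‖F (hartogsChart (w, z))‖ₑ ∂discMeasure)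
        rw [← mul_assoc, ← lintegral_const_mul _ hs]
        refine lintegral_congr fun w => ?_
        ring

/-- The weak-type `(4, 4)` estimate for the iterated absolute Bergman operator on `𝔻 × 𝔻*`. -/
theorem exists_prod_lt_absBergman_le :
    ∃ C : ℝ≥0, ∀ g : ℂ × ℂ → ℝ≥0∞, Measurable g → ∀ t : ℝ≥0∞, t ≠ 0 → t ≠ ∞ →
      (discMeasure.prod weightedDiscMeasure) {p | t * ‖p.2‖ₑ <
        absBergman (fun z => ‖z‖ₑ * absBergman (fun w => g (w, z)) p.1) p.2} ≤
      C * (∫⁻ q, g q ^ 4 ∂(discMeasure.prod weightedDiscMeasure)) / t ^ 4 := by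
  obtain ⟨C₁, hC₁⟩ := exists_lintegral_absBergman_pow_four_le
  obtain ⟨C₂, hC₂⟩ := exists_weightedDiscMeasure_lt_absBergman_le
  refine ⟨C₂ * C₁, fun g hgm t ht0 ht => ?_⟩
  obtain ⟨G, hG⟩ : ∃ G : ℂ × ℂ → ℝ≥0∞, ∀ w z, absBergman (fun w' => g (w', z)) w = G (w, z) :=
    ⟨fun q => absBergman (fun w => g (w, q.2)) q.1, fun _ _ => rfl⟩
  have hGm : Measurable G := by
    have h : G = (fun p : ℂ × ℂ => absBergman (fun w => g (w, p.1)) p.2) ∘ Prod.swap :=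
      funext fun q => (hG q.1 q.2).symm
    rw [h]
    exact (measurable_absBergman_uncurry (g := fun q : ℂ × ℂ => g q.swap)
      (hgm.comp measurable_swap)).comp measurable_swap
  simp only [hG]
  have hEm : MeasurableSet {p : ℂ × ℂ | t * ‖p.2‖ₑ <
      absBergman (fun z => ‖z‖ₑ * G (p.1, z)) p.2} := by
    refine measurableSet_lt (by fun_prop) ?_
    exact measurable_absBergman_uncurry (g := fun q : ℂ × ℂ => ‖q.2‖ₑ * G q) (by fun_prop)
  rw [Measure.prod_apply hEm]
  -- The weak-type bound in `z` holds on every slice `w`, and slice measures add up by Tonelli.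
  -- After the swap, the strong `L⁴` bound in `w` is applied for each fixed `z`.
  calc _ ≤ ∫⁻ w, C₂ * (∫⁻ z, ‖z‖ₑ ^ 2 * G (w, z) ^ 4 ∂discMeasure) / t ^ 4 ∂discMeasure :=
        lintegral_mono fun w => hC₂ (fun z => G (w, z)) (by fun_prop) t ht0 ht
    _ = C₂ * (∫⁻ z, ‖z‖ₑ ^ 2 * ∫⁻ w, G (w, z) ^ 4 ∂discMeasure ∂discMeasure) / t ^ 4 := by
        have hswap : ∫⁻ w, ∫⁻ z, ‖z‖ₑ ^ 2 * G (w, z) ^ 4 ∂discMeasure ∂discMeasure =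
            ∫⁻ z, ‖z‖ₑ ^ 2 * ∫⁻ w, G (w, z) ^ 4 ∂discMeasure ∂discMeasure := by
          rw [lintegral_lintegral_swap (by fun_prop)]
          exact lintegral_congr fun z => lintegral_const_mul _ (by fun_prop)
        simp only [div_eq_mul_inv]
        rw [lintegral_mul_const' _ _ (by simp [ht0]), lintegral_const_mul' _ _ (by simp), hswap]
    _ ≤ C₂ * (∫⁻ z, ‖z‖ₑ ^ 2 * (C₁ * ∫⁻ w, g (w, z) ^ 4 ∂discMeasure) ∂discMeasure) / t ^ 4 := by
        gcongr with z
        simpa only [hG] using hC₁ (fun w => g (w, z)) (by fun_prop)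
    _ = _ := by
        rw [lintegral_prod_symm' _ (by fun_prop),
          lintegral_weightedDiscMeasure (hgm.pow_const 4).lintegral_prod_left']
        simp only [mul_left_comm _ (C₁ : ℝ≥0∞)]
        rw [lintegral_const_mul' _ _ (by simp), ENNReal.coe_mul, mul_assoc]

end BergmanDisc

/-! ### Weak type of the Bergman projection -/

open BergmanDisc in
/-- The Bergman projection on the Hartogs triangle is of weak type `(4, 4)`. -/
theorem theorem4p2 :
    IsWeakType 4 4 (bergmanProjectionLp hartogsTriangle (p := 4) (by norm_num)) := by
  obtain ⟨C, hC⟩ := exists_prod_lt_absBergman_le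
  refine ⟨C, fun f t ht => ?_⟩
  have hmem : MemLp f 2 (volume.restrict (hartogsTriangle : Set (ℂ × ℂ))) :=
    (Lp.memLp f).mono_exponent (by norm_num)
  set F : Lp ℂ 2 (volume.restrict (hartogsTriangle : Set (ℂ × ℂ))) := hmem.toLp f with hF
  set T := ENNReal.ofReal t with hT
  have hT0 : T ≠ 0 := by simpa [T] using ht
  have hTt : T ≠ ∞ := ENNReal.ofReal_ne_top
  change (volume.restrict (hartogsTriangle : Set (ℂ × ℂ)))
    {y | t < ‖bergmanProjection hartogsTriangle F y‖} ≤ _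
  have hPm : Measurable fun η => bergmanProjection hartogsTriangle F η :=
    (Lp.stronglyMeasurable _).measurable
  have hFm : Measurable fun η => F η := (Lp.stronglyMeasurable F).measurable
  set g : ℂ × ℂ → ℝ≥0∞ := fun q => ‖F (hartogsChart q)‖ₑ with hg
  have hgm : Measurable g := (hFm.comp measurable_hartogsChart).enorm
  have hset : MeasurableSet {y | t < ‖bergmanProjection hartogsTriangle F y‖} :=
    measurableSet_lt measurable_const hPm.norm
  calc (volume.restrict (hartogsTriangle : Set (ℂ × ℂ)))
        {y | t < ‖bergmanProjection hartogsTriangle F y‖}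
      = (discMeasure.prod weightedDiscMeasure)
          (hartogsChart ⁻¹' {y | t < ‖bergmanProjection hartogsTriangle F y‖}) :=
        (measurePreserving_hartogsChart.measure_preimage hset.nullMeasurableSet).symm
    _ ≤ (discMeasure.prod weightedDiscMeasure) {p | T * ‖p.2‖ₑ <
        absBergman (fun z => ‖z‖ₑ * absBergman (fun w => g (w, z)) p.1) p.2} := by
        -- Multiplying `T < |P F|` by `|z|` keeps the inequality strict because `z ≠ 0` almost
        -- everywhere; the pointwise domination then applies.
        refine measure_mono_ae ?_
        filter_upwards [enorm_bergmanProjection_hartogs_le F,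
          Measure.quasiMeasurePreserving_snd.ae ae_weightedDiscMeasure] with p hp hp2 hpt
        have hpt : t < ‖bergmanProjection hartogsTriangle F (hartogsChart p)‖ := hpt
        have hlt : T < ‖bergmanProjection hartogsTriangle F (hartogsChart p)‖ₑ := by
          rw [hT, ← ofReal_norm]
          exact (ENNReal.ofReal_lt_ofReal_iff (ht.trans hpt)).mpr hpt
        change T * ‖p.2‖ₑ < _
        refine lt_of_lt_of_le ?_ hp
        rw [mul_comm]
        exact (ENNReal.mul_lt_mul_iff_right (by simpa using hp2.2) enorm_ne_top).mpr hlt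
    _ ≤ C * (∫⁻ q, g q ^ 4 ∂(discMeasure.prod weightedDiscMeasure)) / T ^ 4 :=
        hC g hgm T hT0 hTt
    _ = _ := by
        have h1 : ∫⁻ q, g q ^ 4 ∂(discMeasure.prod weightedDiscMeasure) =
            eLpNorm f 4 (volume.restrict (hartogsTriangle : Set (ℂ × ℂ))) ^ (4 : ℝ) := by
          rw [measurePreserving_hartogsChart.lintegral_comp (f := fun η => ‖F η‖ₑ ^ 4)
            (by fun_prop), eLpNorm_eq_lintegral_rpow_enorm_toReal (by norm_num) (by norm_num),
            ← ENNReal.rpow_mul]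
          norm_num
          refine lintegral_congr_ae (hmem.coeFn_toLp.mono fun η hη => ?_)
          simp only
          rw [hF, hη]
        rw [h1, show (4 : ℝ) = ((4 : ℕ) : ℝ) by norm_num,
          ENNReal.rpow_natCast T]
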